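/- Let $S=K[t_1,\ldots,t_s]$ be a polynomial ring over a field $K$, let $v_1,\ldots,v_m\in\mathbb{N}^s$, and let $K[F]=K[t^{v_1},\ldots,t^{v_m}]$ be the $K$-subalgebra of $S$ generated by the monomials $t^{v_1},\ldots,t^{v_m}$. Suppose that $K[F]$ is a Cohen--Macaulay ring and that $K[F]=\bigoplus_{i\geq 0}K[F]_i$ is standard graded, i.e. graded as a $K$-algebra with $K[F]_0=K$ and $K[F]$ generated by $K[F]_1$ (for instance, by a grading in which every $t^{v_i}$ has degree $1$, when there is one). Let $A$ be the matrix with columns $v_1,\ldots,v_m$, and let $\operatorname{rank}(A)$ be its rank over $\mathbb{Q}$. Then the Hilbert series $\sum_{i\geq 0}\dim_K(K[F]_i)\,x^i$ is a rational function, the Castelnuovo--Mumford regularity $\operatorname{reg}(K[F])$ is well defined, and $$\operatorname{reg}(K[F])=a(K[F])+\operatorname{rank}(A).$$ Here the $a$-invariant $a(K[F])$ is the degree of the Hilbert series as a rational function (degree of numerator minus degree of denominator), and $\operatorname{reg}(K[F])$ is the maximum of the numbers $b-i$ such that $R(-b)$ is a direct summand of the $i$-th module of a minimal graded free resolution of $K[F]$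 over a polynomial ring $R=K[x_1,\ldots,x_n]$ with its standard grading, where $R$ is mapped onto $K[F]$ by sending the variables to $K$-algebra generators of degree $1$; such presentations and resolutions exist, and this number depends neither on the choice of the generators nor on that of the resolution. -/

import Mathlib

section GradedAlgebras

variable {K : Type*} [Field K] {A : Type*} [CommRing A] [Algebra K A]

/-- The graded `K`-algebra `A = ⨁ 𝒜 i` is standard graded: its degree-zero part is `K` and it is
generated by its degree-one part. (Finite generation is automatic for the algebras `K[F]` below.) -/
structure IsStandardGraded (𝒜 : ℕ → Submodule K A) [GradedAlgebra 𝒜] : Prop where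
  degree_zero : 𝒜 0 = LinearMap.range (Algebra.linearMap K A)
  generated : Algebra.adjoin K (𝒜 1 : Set A) = ⊤

/-- The Hilbert series `∑ dim_K(A_i) x^i`. -/
noncomputable def hilbertSeries (𝒜 : ℕ → Submodule K A) : PowerSeries ℚ :=
  PowerSeries.mk fun i => (Module.finrank K (𝒜 i) : ℚ)

/-- The Hilbert series is a nonzero rational function `p / q`, and its degree
`deg p - deg q` is `a`. -/
def HasAInvariant (𝒜 : ℕ → Submodule K A) (a : ℤ) : Prop :=
  ∃ p q : Polynomial ℚ, p ≠ 0 ∧ q ≠ 0 ∧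
    (q : PowerSeries ℚ) * hilbertSeries 𝒜 = (p : PowerSeries ℚ) ∧
    a = (p.natDegree : ℤ) - (q.natDegree : ℤ)

theorem HasAInvariant.unique {𝒜 : ℕ → Submodule K A} {a b : ℤ}
    (ha : HasAInvariant 𝒜 a) (hb : HasAInvariant 𝒜 b) : a = b := by
  obtain ⟨p, q, hp, hq, h, rfl⟩ := ha
  obtain ⟨p', q', hp', hq', h', rfl⟩ := hb
  have e : p * q' = p' * q := by
    apply Polynomial.coe_injective ℚ
    rw [Polynomial.coe_mul, Polynomial.coe_mul, ← h, ← h']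
    ring
  have d := congrArg Polynomial.natDegree e
  rw [Polynomial.natDegree_mul hp hq', Polynomial.natDegree_mul hp' hq] at d
  omega

open Classical in
/-- The `a`-invariant: the degree, as a rational function, of the Hilbert series
(with the value `0` if the series is not a nonzero rational function). -/
noncomputable def aInvariant (𝒜 : ℕ → Submodule K A) : ℤ :=
  if h : ∃ a, HasAInvariant 𝒜 a then h.choose else 0

/-- `x` is a finite family of `K`-algebra generators of `A`, all of degree one. It presents `A` as a
graded quotient of the polynomial ring `R = K[X_1, …, X_n]` (standard grading, `X_i ↦ x_i`). -/
structure IsLinearGenerators (𝒜 : ℕ → Submodule K A) {n : ℕ} (x : Fin n → A) : Prop where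
  mem : ∀ i, x i ∈ 𝒜 1
  generate : Algebra.adjoin K (Set.range x) = ⊤

/-- A minimal graded free resolution
`⋯ → F_2 → F_1 → F_0 → A → 0` of `A`, seen as a graded module over `R = K[X_1, …, X_n]` through
`X_i ↦ x_i`. Here `F_i = ⨁_k R(-shift i k)` is free of rank `rank i`, the differential
`F_{i+1} → F_i` is multiplication by the matrix `diff i`, and `F_0 → A` sends the `k`-th basis
vector to `gen k`. All maps are homogeneous of degree zero, and minimality says that the image of
each differential lies in `(X_1, …, X_n) F_i`. (As `A` lives in nonnegative degrees, the shifts of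
a minimal resolution are nonnegative.) -/
structure MinimalGradedFreeResolution (𝒜 : ℕ → Submodule K A) {n : ℕ} (x : Fin n → A) where
  rank : ℕ → ℕ
  shift : (i : ℕ) → Fin (rank i) → ℕ
  gen : Fin (rank 0) → A
  diff : (i : ℕ) → Matrix (Fin (rank i)) (Fin (rank (i + 1))) (MvPolynomial (Fin n) K)
  gen_mem : ∀ k, gen k ∈ 𝒜 (shift 0 k)
  diff_homogeneous : ∀ i k l, diff i k l ≠ 0 →
    ∃ e : ℕ, shift i k + e = shift (i + 1) l ∧ (diff i k l).IsHomogeneous e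
  surjective : ∀ y : A, ∃ f : Fin (rank 0) → MvPolynomial (Fin n) K,
    ∑ k, MvPolynomial.aeval x (f k) * gen k = y
  exact_zero : ∀ f : Fin (rank 0) → MvPolynomial (Fin n) K,
    ∑ k, MvPolynomial.aeval x (f k) * gen k = 0 ↔ ∃ g, f = (diff 0).mulVec g
  exact_succ : ∀ (i : ℕ) (f : Fin (rank (i + 1)) → MvPolynomial (Fin n) K),
    (diff i).mulVec f = 0 ↔ ∃ g, f = (diff (i + 1)).mulVec g
  minimal : ∀ i k l, MvPolynomial.constantCoeff (diff i k l) = 0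

/-- The integers `b - i`, where `R(-b)` is a summand of the `i`-th module of the resolution. -/
def MinimalGradedFreeResolution.regularityDegrees {𝒜 : ℕ → Submodule K A} {n : ℕ} {x : Fin n → A}
    (P : MinimalGradedFreeResolution 𝒜 x) : Set ℤ :=
  {d | ∃ (i : ℕ) (k : Fin (P.rank i)), d = (P.shift i k : ℤ) - (i : ℤ)}

/-- `r` is the Castelnuovo–Mumford regularity of `A`: minimal graded free resolutions of `A` over
polynomial rings mapping onto it (as above) exist, and in each of them `r` is the maximum of the
numbers `b - i` such that `R(-b)` is a summand of the `i`-th module. -/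
def HasRegularity (𝒜 : ℕ → Submodule K A) (r : ℤ) : Prop :=
  (∃ (n : ℕ) (x : Fin n → A), IsLinearGenerators 𝒜 x) ∧
  ∀ (n : ℕ) (x : Fin n → A), IsLinearGenerators 𝒜 x →
    Nonempty (MinimalGradedFreeResolution 𝒜 x) ∧
    ∀ P : MinimalGradedFreeResolution 𝒜 x, IsGreatest P.regularityDegrees r

theorem HasRegularity.unique {𝒜 : ℕ → Submodule K A} {r r' : ℤ}
    (h : HasRegularity 𝒜 r) (h' : HasRegularity 𝒜 r') : r = r' := by
  obtain ⟨⟨n, x, hx⟩, H⟩ := h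
  obtain ⟨⟨P⟩, hP⟩ := H n x hx
  exact (hP P).unique ((h'.2 n x hx).2 P)

open Classical in
/-- The Castelnuovo–Mumford regularity (with the value `0` if there is none). -/
noncomputable def regularity (𝒜 : ℕ → Submodule K A) : ℤ :=
  if h : ∃ r, HasRegularity 𝒜 r then h.choose else 0

end GradedAlgebras

/-- A Noetherian ring is Cohen–Macaulay if the grade (depth) of every maximal ideal `𝔪` equals its
height, i.e. if `𝔪` contains a regular sequence of length `height 𝔪`. -/
structure IsCohenMacaulay (A : Type*) [CommRing A] : Prop where
  noetherian : IsNoetherianRing A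
  exists_regular : ∀ 𝔪 : Ideal A, 𝔪.IsMaximal →
    ∃ rs : List A, (∀ r ∈ rs, r ∈ 𝔪) ∧ RingTheory.Sequence.IsRegular A rs ∧
      (rs.length : ℕ∞) = 𝔪.height

/-- The monomial subring `K[F] = K[t^{v_1}, …, t^{v_m}]` of `S = K[t_1, …, t_s]`. -/
noncomputable def monomialSubring (K : Type*) [Field K] {s m : ℕ} (v : Fin m → (Fin s →₀ ℕ)) :
    Subalgebra K (MvPolynomial (Fin s) K) :=
  Algebra.adjoin K (Set.range fun i => MvPolynomial.monomial (v i) (1 : K))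

/-- The `s × m` matrix with columns `v_1, …, v_m`. -/
def exponentMatrix {s m : ℕ} (v : Fin m → (Fin s →₀ ℕ)) : Matrix (Fin s) (Fin m) ℚ :=
  Matrix.of fun j i => (v i j : ℚ)

/-! Write `A` for `K[F]`, `𝔪` for its irrelevant ideal, `x` for a family of `n` linear generators,
and `H_p(-)_j` for Koszul homology on `x`. Both invariants are read off from one homogeneous regular
sequence `θ_1, …, θ_d` with `d = ht 𝔪` and degrees `e_i > 0`, generating an ideal `J` such that
`A/J` has finite length and top degree `t`.

Existence: Cohen–Macaulayness gives a regular sequence of length `d` in `𝔪`, perhaps not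
homogeneous. It forces `H_p(A) = 0` for `p > n - d`. Conversely, vanishing of `H_n` means that the
socle is zero, so no associated prime contains `𝔪`, and prime avoidance finds a homogeneous regular
element. Iterating gives the `θ_i` (`exists_isHomogeneousRegular`), and counting heights shows that
`𝔪` is the radical of `J`.

The `a`-invariant: killing `θ_i` multiplies the Hilbert series by `1 - x^{e_i}`, so `a = t - ∑ e_i`.

Regularity: the shifts in the `p`-th module of a minimal resolution are the `j` with `H_p(A)_j ≠ 0`,
that is `Tor_p(A, K)_j ≠ 0` (`MinimalGradedFreeResolution.koszulVanishes_iff`). For `A/J` the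
maximum of `j - p` is `t`, and killing `θ_i` raises this maximum by `e_i - 1`
(`koszulVanishes_quotient_iff`). Hence `reg = t - ∑ e_i + d = a + d`.

Rank: the `θ_i` form a transcendence basis of `A` over `K`, and so do the monomials whose exponents
form a maximal linearly independent set of columns. Hence `d = rank` (`rank_exponentMatrix_eq`). -/

/-! ### The Koszul complex, its homotopies, functoriality and bigrading -/

section KoszulComplex

/-- The underlying group of the Koszul complex of `n` commuting operators on `M`, built as an
iterated mapping cone. -/
def KoszulChain (M : Type*) : ℕ → Type _
  | 0 => M
  | n + 1 => KoszulChain M n × KoszulChain M n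

namespace KoszulChain

instance instAddCommGroup (M : Type*) [AddCommGroup M] : ∀ n, AddCommGroup (KoszulChain M n)
  | 0 => inferInstanceAs (AddCommGroup M)
  | n + 1 =>
    letI := instAddCommGroup M n
    inferInstanceAs (AddCommGroup (KoszulChain M n × KoszulChain M n))

instance instModule (R M : Type*) [CommRing R] [AddCommGroup M] [Module R M] :
    ∀ n, Module R (KoszulChain M n)
  | 0 => inferInstanceAs (Module R M)
  | n + 1 =>
    letI := instModule R M n
    inferInstanceAs (Module R (KoszulChain M n × KoszulChain M n))

section Components

variable {M : Type*} {n : ℕ}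

def fst (z : KoszulChain M (n + 1)) : KoszulChain M n := Prod.fst z

def snd (z : KoszulChain M (n + 1)) : KoszulChain M n := Prod.snd z

def mk (a b : KoszulChain M n) : KoszulChain M (n + 1) := Prod.mk a b

@[simp] theorem fst_mk (a b : KoszulChain M n) : fst (mk a b) = a := rfl

@[simp] theorem snd_mk (a b : KoszulChain M n) : snd (mk a b) = b := rfl

theorem ext_components {z w : KoszulChain M (n + 1)} (h₁ : fst z = fst w) (h₂ : snd z = snd w) :
    z = w := Prod.ext h₁ h₂

variable {R : Type*} [CommRing R] [AddCommGroup M] [Module R M]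

@[simp] theorem fst_add (z w : KoszulChain M (n + 1)) : fst (z + w) = fst z + fst w := rfl

@[simp] theorem snd_add (z w : KoszulChain M (n + 1)) : snd (z + w) = snd z + snd w := rfl

@[simp] theorem fst_zero : fst (0 : KoszulChain M (n + 1)) = 0 := rfl

@[simp] theorem snd_zero : snd (0 : KoszulChain M (n + 1)) = 0 := rfl

@[simp] theorem fst_smul (r : R) (z : KoszulChain M (n + 1)) : fst (r • z) = r • fst z := rfl

@[simp] theorem snd_smul (r : R) (z : KoszulChain M (n + 1)) : snd (r • z) = r • snd z := rfl

end Components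

section Differential

variable {R M : Type*} [CommRing R] [AddCommGroup M] [Module R M]

/-- The Koszul differential of the elements `x 0, …, x (n - 1)`. -/
def d (M : Type*) [AddCommGroup M] [Module R M] (x : ℕ → R) :
    ∀ n, KoszulChain M n →ₗ[R] KoszulChain M n
  | 0 => 0
  | n + 1 =>
    -- The second component is the coefficient of the new exterior generator; the sign cancels the
    -- cross terms in `d ∘ d`.
    { toFun := fun z => mk (d M x n (fst z) + x n • snd z) (-(d M x n (snd z)))
      map_add' := fun z w => ext_components
        (by simp only [fst_mk, fst_add, snd_add, map_add, smul_add]; abel)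
        (by simp only [snd_mk, snd_add, map_add, neg_add])
      map_smul' := fun r z => ext_components
        (by simp only [fst_mk, fst_smul, snd_smul, map_smul, smul_add, RingHom.id_apply,
              smul_comm r (x n)])
        (by simp only [snd_mk, snd_smul, map_smul, smul_neg, RingHom.id_apply]) }

@[simp] theorem fst_d (x : ℕ → R) (n : ℕ) (z : KoszulChain M (n + 1)) :
    fst (d M x (n + 1) z) = d M x n (fst z) + x n • snd z := rfl

@[simp] theorem snd_d (x : ℕ → R) (n : ℕ) (z : KoszulChain M (n + 1)) :
    snd (d M x (n + 1) z) = -(d M x n (snd z)) := rfl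

theorem d_d (x : ℕ → R) : ∀ n (z : KoszulChain M n), d M x n (d M x n z) = 0
  | 0, _ => rfl
  | n + 1, z => ext_components
      (by simp only [fst_d, snd_d, map_add, map_smul, d_d x n, smul_neg, fst_zero]; abel)
      (by simp only [snd_d, map_neg, d_d x n, neg_zero, snd_zero])

/-- The homotopy is exterior multiplication by the `i`-th generator: for the last generator it moves
the first component into the second, for an earlier one it acts on both components with a sign. -/
theorem exists_homotopy_of_lt (x : ℕ → R) (i : ℕ) : ∀ n, i < n →
    ∃ h : KoszulChain M n →ₗ[R] KoszulChain M n,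
      ∀ z, d M x n (h z) + h (d M x n z) = x i • z
  | 0, hi => absurd hi (Nat.not_lt_zero i)
  | n + 1, hi => by
    rcases Nat.lt_succ_iff_lt_or_eq.1 hi with hi | rfl
    · obtain ⟨h, hh⟩ := exists_homotopy_of_lt x i n hi
      refine ⟨{ toFun := fun z => mk (h (fst z)) (-(h (snd z)))
                map_add' := fun z w => ext_components
                  (by simp only [fst_mk, fst_add, map_add])
                  (by simp only [snd_mk, snd_add, map_add, neg_add])
                map_smul' := fun r z => ext_components
                  (by simp only [fst_mk, fst_smul, map_smul, RingHom.id_apply])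
                  (by simp only [snd_mk, snd_smul, map_smul, smul_neg, RingHom.id_apply]) },
        fun z => ext_components ?_ ?_⟩
      · simp only [LinearMap.coe_mk, AddHom.coe_mk, fst_add, fst_d, fst_mk, snd_mk, map_add,
          map_smul, smul_neg, fst_smul, ← hh]
        abel
      · simp only [LinearMap.coe_mk, AddHom.coe_mk, snd_add, snd_d, snd_mk, map_neg,
          snd_smul, ← hh]
        abel
    · refine ⟨{ toFun := fun z => mk 0 (fst z)
                map_add' := fun z w => ext_components (by simp only [fst_mk, fst_add, add_zero])
                  (by simp only [snd_mk, snd_add, fst_add])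
                map_smul' := fun r z => ext_components
                  (by simp only [fst_mk, fst_smul, smul_zero])
                  (by simp only [snd_mk, snd_smul, fst_smul, RingHom.id_apply]) },
        fun z => ext_components ?_ ?_⟩
      · simp only [LinearMap.coe_mk, AddHom.coe_mk, fst_add, fst_d, fst_mk, snd_mk, map_zero,
          zero_add, add_zero, fst_smul]
      · simp only [LinearMap.coe_mk, AddHom.coe_mk, snd_add, snd_d, snd_mk, fst_d, snd_smul]
        abel

/-- Elements of the ideal generated by the `x i` act null-homotopically on the Koszul complex. -/
theorem exists_homotopy (x : ℕ → R) (n : ℕ) {θ : R} (hθ : θ ∈ Ideal.span (x '' Set.Iio n)) :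
    ∃ h : KoszulChain M n →ₗ[R] KoszulChain M n,
      ∀ z, d M x n (h z) + h (d M x n z) = θ • z := by
  induction hθ using Submodule.span_induction with
  | mem y hy =>
    obtain ⟨i, hi, rfl⟩ := hy
    exact exists_homotopy_of_lt x i n hi
  | zero => exact ⟨0, fun z => by simp⟩
  | add y z _ _ hy hz =>
    obtain ⟨h, hh⟩ := hy
    obtain ⟨k, hk⟩ := hz
    refine ⟨h + k, fun w => ?_⟩
    rw [add_smul, ← hh, ← hk, LinearMap.add_apply, LinearMap.add_apply, map_add]
    abel
  | smul r y _ hy =>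
    obtain ⟨h, hh⟩ := hy
    refine ⟨r • h, fun w => ?_⟩
    rw [smul_eq_mul, mul_smul, ← hh, LinearMap.smul_apply, LinearMap.smul_apply, map_smul, smul_add]

end Differential

section Functoriality

variable {M N L : Type*} [AddCommGroup M] [AddCommGroup N] [AddCommGroup L]

/-- The map of Koszul complexes induced by an additive map. -/
def map (f : M →+ N) : ∀ n, KoszulChain M n →+ KoszulChain N n
  | 0 => f
  | n + 1 =>
    { toFun := fun z => mk (map f n (fst z)) (map f n (snd z))
      map_zero' := ext_components (by simp only [fst_mk, fst_zero, map_zero])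
        (by simp only [snd_mk, snd_zero, map_zero])
      map_add' := fun z w => ext_components (by simp only [fst_mk, fst_add, map_add])
        (by simp only [snd_mk, snd_add, map_add]) }

@[simp] theorem fst_map (f : M →+ N) (n : ℕ) (z : KoszulChain M (n + 1)) :
    fst (map f (n + 1) z) = map f n (fst z) := rfl

@[simp] theorem snd_map (f : M →+ N) (n : ℕ) (z : KoszulChain M (n + 1)) :
    snd (map f (n + 1) z) = map f n (snd z) := rfl

theorem map_smul_eq {R S : Type*} [CommRing R] [CommRing S] [Module R M] [Module S N]
    {f : M →+ N} {r : R} {s : S} (hf : ∀ y, f (r • y) = s • f y) :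
    ∀ n (z : KoszulChain M n), map f n (r • z) = s • map f n z
  | 0, z => hf z
  | n + 1, z => ext_components
      (by simp only [fst_map, fst_smul, map_smul_eq hf n])
      (by simp only [snd_map, snd_smul, map_smul_eq hf n])

/-- The two scalar rings may differ, so that the complex on `X` over a polynomial ring can be
compared with the complex on `x` over `A`. -/
theorem map_d {R S : Type*} [CommRing R] [CommRing S] [Module R M] [Module S N]
    {f : M →+ N} {x : ℕ → R} {y : ℕ → S} :
    ∀ n, (∀ i < n, ∀ m, f (x i • m) = y i • f m) →
      ∀ z : KoszulChain M n, map f n (d M x n z) = d N y n (map f n z)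
  | 0, _, _ => map_zero f
  | n + 1, hf, z => by
    have ih := map_d (f := f) n fun i hi => hf i (hi.trans n.lt_succ_self)
    exact ext_components
      (by simp only [fst_map, fst_d, snd_map, map_add, ih, map_smul_eq (hf n n.lt_succ_self)])
      (by simp only [snd_map, snd_d, map_neg, ih])

theorem map_surjective {f : M →+ N} (hf : Function.Surjective f) :
    ∀ n, Function.Surjective (map f n)
  | 0 => hf
  | n + 1 => fun z => by
    obtain ⟨a, ha⟩ := map_surjective hf n (fst z)
    obtain ⟨b, hb⟩ := map_surjective hf n (snd z)
    exact ⟨mk a b, ext_components ha hb⟩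

theorem map_injective {f : M →+ N} (hf : Function.Injective f) :
    ∀ n, Function.Injective (map f n)
  | 0 => hf
  | n + 1 => fun _ _ h => ext_components (map_injective hf n (congrArg fst h))
      (map_injective hf n (congrArg snd h))

theorem map_exact {f : M →+ N} {g : N →+ L} (h : Function.Exact f g) :
    ∀ n, Function.Exact (map f n) (map g n)
  | 0 => h
  | n + 1 => fun z => by
    constructor
    · intro hz
      obtain ⟨a, ha⟩ := (map_exact h n (fst z)).1 (congrArg fst hz)
      obtain ⟨b, hb⟩ := (map_exact h n (snd z)).1 (congrArg snd hz)
      exact ⟨mk a b, ext_components ha hb⟩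
    · rintro ⟨w, rfl⟩
      exact ext_components ((map_exact h n _).2 ⟨_, rfl⟩) ((map_exact h n _).2 ⟨_, rfl⟩)

end Functoriality

section Bigrading

variable {M N : Type*} [AddCommGroup M] [AddCommGroup N]

/-- The projection of the Koszul complex onto its part of homological degree `p` and internal
degree `j`, where `π` is the family of projections onto the homogeneous parts of `M`. -/
def proj (π : ℤ → M →+ M) : ∀ n, ℤ → ℤ → KoszulChain M n →+ KoszulChain M n
  | 0, p, j => if p = 0 then π j else 0
  | n + 1, p, j =>
    -- Each exterior generator has homological degree one and internal degree one.
    { toFun := fun z => mk (proj π n p j (fst z)) (proj π n (p - 1) (j - 1) (snd z))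
      map_zero' := ext_components (by simp only [fst_mk, fst_zero, map_zero])
        (by simp only [snd_mk, snd_zero, map_zero])
      map_add' := fun z w => ext_components (by simp only [fst_mk, fst_add, map_add])
        (by simp only [snd_mk, snd_add, map_add]) }

variable {π : ℤ → M →+ M} {ρ : ℤ → N →+ N}

@[simp] theorem fst_proj (n : ℕ) (p j : ℤ) (z : KoszulChain M (n + 1)) :
    fst (proj π (n + 1) p j z) = proj π n p j (fst z) := rfl

@[simp] theorem snd_proj (n : ℕ) (p j : ℤ) (z : KoszulChain M (n + 1)) :
    snd (proj π (n + 1) p j z) = proj π n (p - 1) (j - 1) (snd z) := rfl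

theorem proj_zero_eq (j : ℤ) : proj π 0 0 j = π j := if_pos rfl

theorem proj_zero_of_ne {p : ℤ} (hp : p ≠ 0) (j : ℤ) : proj π 0 p j = 0 := if_neg hp

theorem proj_of_neg : ∀ n {p : ℤ}, p < 0 → ∀ j (z : KoszulChain M n), proj π n p j z = 0
  | 0, p, hp, j, z => by rw [proj_zero_of_ne hp.ne]; rfl
  | n + 1, p, hp, j, z => ext_components (by simp only [fst_proj, proj_of_neg n hp, fst_zero])
      (by simp only [snd_proj, proj_of_neg n (show p - 1 < 0 by omega), snd_zero])

theorem proj_of_gt : ∀ (n : ℕ) {p : ℤ}, (n : ℤ) < p → ∀ j (z : KoszulChain M n), proj π n p j z = 0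
  | 0, p, hp, j, z => by rw [proj_zero_of_ne (by push_cast at hp; omega)]; rfl
  | n + 1, p, hp, j, z => ext_components
      (by simp only [fst_proj, proj_of_gt n (show (n : ℤ) < p by push_cast at hp; omega), fst_zero])
      (by simp only [snd_proj, proj_of_gt n (show (n : ℤ) < p - 1 by push_cast at hp; omega),
            snd_zero])

/-- As the exterior generators have bidegree `(1, 1)`, the difference `j - p` is the degree of the
coefficients in `M`. -/
theorem proj_eq_zero {c : ℤ} (hπ : ∀ j, c < j → π j = 0) : ∀ n {p j : ℤ}, c < j - p →
    ∀ z : KoszulChain M n, proj π n p j z = 0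
  | 0, p, j, h, z => by
    by_cases hp : p = 0
    · subst hp
      rw [proj_zero_eq, hπ j (by omega)]; rfl
    · rw [proj_zero_of_ne hp]; rfl
  | n + 1, p, j, h, z => ext_components
      (by simp only [fst_proj, proj_eq_zero hπ n h, fst_zero])
      (by simp only [snd_proj, proj_eq_zero hπ n (show c < (j - 1) - (p - 1) by omega), snd_zero])

theorem proj_proj (h : ∀ j y, π j (π j y) = π j y) :
    ∀ n p j (z : KoszulChain M n), proj π n p j (proj π n p j z) = proj π n p j z
  | 0, p, j, z => by
    by_cases hp : p = 0
    · subst hp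
      rw [proj_zero_eq]
      exact h j z
    · rw [proj_zero_of_ne hp]; rfl
  | n + 1, p, j, z => ext_components (by simp only [fst_proj, proj_proj h n])
      (by simp only [snd_proj, proj_proj h n])

/-- Forgetting the internal grading. -/
theorem proj_id_proj : ∀ n p j (z : KoszulChain M n),
    proj (fun _ => AddMonoidHom.id M) n p 0 (proj π n p j z) = proj π n p j z := by
  suffices ∀ n p i j (z : KoszulChain M n),
      proj (fun _ => AddMonoidHom.id M) n p i (proj π n p j z) = proj π n p j z from
    fun n p j z => this n p 0 j z
  intro n
  induction n with
  | zero =>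
    intro p i j z
    by_cases hp : p = 0
    · subst hp
      rw [proj_zero_eq]; rfl
    · rw [proj_zero_of_ne hp, proj_zero_of_ne hp]; rfl
  | succ n ih =>
    exact fun p i j z => ext_components (by simp only [fst_proj, ih]) (by simp only [snd_proj, ih])

theorem map_proj {f : M →+ N} (h : ∀ j y, f (π j y) = ρ j (f y)) :
    ∀ n p j (z : KoszulChain M n), map f n (proj π n p j z) = proj ρ n p j (map f n z)
  | 0, p, j, z => by
    by_cases hp : p = 0
    · subst hp
      rw [proj_zero_eq, proj_zero_eq]
      exact h j z
    · rw [proj_zero_of_ne hp, proj_zero_of_ne hp]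
      exact map_zero f
  | n + 1, p, j, z => ext_components (by simp only [fst_map, fst_proj, map_proj h n])
      (by simp only [snd_map, snd_proj, map_proj h n])

variable {R : Type*} [CommRing R] [Module R M] [Module R N] {x : ℕ → R}

theorem proj_smul {r : R} {e : ℤ} (h : ∀ j y, π j (r • y) = r • π (j - e) y) :
    ∀ n p j (z : KoszulChain M n), proj π n p j (r • z) = r • proj π n p (j - e) z
  | 0, p, j, z => by
    by_cases hp : p = 0
    · subst hp
      rw [proj_zero_eq, proj_zero_eq]
      exact h j z
    · rw [proj_zero_of_ne hp, proj_zero_of_ne hp]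
      exact (smul_zero r).symm
  | n + 1, p, j, z => ext_components (by simp only [fst_smul, fst_proj, proj_smul h n])
      (by simp only [snd_smul, snd_proj, proj_smul h n, sub_right_comm])

/-- The differential trades a generator of internal degree one for an operator of degree one, so its
bidegree is `(-1, 0)`. -/
theorem d_proj : ∀ n, (∀ i < n, ∀ j y, π j (x i • y) = x i • π (j - 1) y) →
    ∀ p j (z : KoszulChain M n), d M x n (proj π n p j z) = proj π n (p - 1) j (d M x n z)
  | 0, _, p, j, z => (map_zero (proj π 0 (p - 1) j)).symm
  | n + 1, h, p, j, z => by
    have ih := d_proj n fun i hi => h i (hi.trans n.lt_succ_self)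
    exact ext_components
      (by simp only [fst_proj, fst_d, snd_proj, map_add, ih, proj_smul (h n n.lt_succ_self)])
      (by simp only [snd_proj, snd_d, map_neg, ih])

end Bigrading

end KoszulChain

end KoszulComplex

/-! ### Vanishing of Koszul homology: extreme degrees, exact sequences, regular elements -/

section KoszulVanishing

open KoszulChain

namespace KoszulChain

variable {R M : Type*} [CommRing R] [AddCommGroup M] [Module R M]

/-- The inclusion of `M` as the part of homological degree zero. -/
def base (R M : Type*) [CommRing R] [AddCommGroup M] [Module R M] : ∀ n, M →ₗ[R] KoszulChain M n
  | 0 => LinearMap.id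
  | n + 1 =>
    { toFun := fun y => mk (base R M n y) 0
      map_add' := fun y z => ext_components (by simp only [fst_mk, fst_add, map_add])
        (by simp only [snd_mk, snd_add, add_zero])
      map_smul' := fun r y => ext_components
        (by simp only [fst_mk, fst_smul, map_smul, RingHom.id_apply])
        (by simp only [snd_mk, snd_smul, smul_zero]) }

/-- The projection to the part of homological degree zero. -/
def augment (M : Type*) : ∀ n, KoszulChain M n → M
  | 0, z => z
  | n + 1, z => augment M n (fst z)

/-- The inclusion of `M` as the part of homological degree `n`. -/
def top (R M : Type*) [CommRing R] [AddCommGroup M] [Module R M] : ∀ n, M →ₗ[R] KoszulChain M n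
  | 0 => LinearMap.id
  | n + 1 =>
    { toFun := fun y => mk 0 (top R M n y)
      map_add' := fun y z => ext_components (by simp only [fst_mk, fst_add, add_zero])
        (by simp only [snd_mk, snd_add, map_add])
      map_smul' := fun r y => ext_components (by simp only [fst_mk, fst_smul, smul_zero])
        (by simp only [snd_mk, snd_smul, map_smul, RingHom.id_apply]) }

theorem fst_base (n : ℕ) (y : M) : fst (base R M (n + 1) y) = base R M n y := rfl

theorem snd_base (n : ℕ) (y : M) : snd (base R M (n + 1) y) = 0 := rfl

theorem fst_top (n : ℕ) (y : M) : fst (top R M (n + 1) y) = 0 := rfl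

theorem snd_top (n : ℕ) (y : M) : snd (top R M (n + 1) y) = top R M n y := rfl

theorem augment_succ {L : Type*} (n : ℕ) (z : KoszulChain L (n + 1)) :
    augment L (n + 1) z = augment L n (fst z) := rfl

theorem augment_base : ∀ n (y : M), augment M n (base R M n y) = y
  | 0, _ => rfl
  | n + 1, y => augment_base n y

theorem augment_add : ∀ n (z w : KoszulChain M n),
    augment M n (z + w) = augment M n z + augment M n w
  | 0, _, _ => rfl
  | n + 1, z, w => augment_add n (fst z) (fst w)

theorem augment_smul (r : R) : ∀ n (z : KoszulChain M n),
    augment M n (r • z) = r • augment M n z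
  | 0, _ => rfl
  | n + 1, z => augment_smul r n (fst z)

theorem map_lsmul (r : R) : ∀ n (z : KoszulChain M n),
    map (LinearMap.lsmul R M r).toAddMonoidHom n z = r • z
  | 0, _ => rfl
  | n + 1, z => ext_components (by rw [fst_map, map_lsmul r n, fst_smul])
      (by rw [snd_map, map_lsmul r n, snd_smul])

theorem proj_zero_left (π : ℤ → M →+ M) (j : ℤ) : ∀ n (z : KoszulChain M n),
    proj π n 0 j z = base R M n (π j (augment M n z))
  | 0, z => by rw [proj_zero_eq]; rfl
  | n + 1, z => ext_components (by simp only [fst_proj, proj_zero_left π j n, fst_base,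
      augment_succ]) (by simp only [snd_proj, snd_base]; exact proj_of_neg n (by omega) _ _)

theorem d_base (x : ℕ → R) : ∀ n (y : M), d M x n (base R M n y) = 0
  | 0, _ => rfl
  | n + 1, y => ext_components (by simp only [fst_d, fst_base, snd_base, d_base x n, smul_zero,
      add_zero, fst_zero]) (by simp only [snd_d, snd_base, map_zero, neg_zero, snd_zero])

theorem top_injective : ∀ n, Function.Injective (top R M n)
  | 0 => Function.injective_id
  | n + 1 => fun _ _ h => top_injective n (congrArg snd h)

theorem d_top (x : ℕ → R) {y : M} : ∀ n, (∀ i < n, x i • y = 0) → d M x n (top R M n y) = 0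
  | 0, _ => rfl
  | n + 1, h => ext_components
      (by rw [fst_d, fst_top, snd_top, map_zero, zero_add, ← map_smul, h n n.lt_succ_self,
            map_zero, fst_zero])
      (by rw [snd_d, snd_top, d_top x n fun i hi => h i (hi.trans n.lt_succ_self), neg_zero,
            snd_zero])

theorem proj_top (π : ℤ → M →+ M) (y : M) : ∀ (n : ℕ) (j : ℤ),
    proj π n n (j + n) (top R M n y) = top R M n (π j y)
  | 0, j => by
    rw [Nat.cast_zero, proj_zero_eq, add_zero]; rfl
  | n + 1, j => ext_components (by simp only [fst_proj, fst_top, map_zero])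
      (by
        have := proj_top π y n j
        simp only [snd_proj, snd_top, Nat.cast_succ, add_sub_cancel_right, ← add_assoc, this])

theorem augment_d_mem (x : ℕ → R) : ∀ n (z : KoszulChain M n),
    augment M n (d M x n z) ∈ Ideal.span (x '' Set.Iio n) • (⊤ : Submodule R M)
  | 0, _ => Submodule.zero_mem _
  | n + 1, z => by
    rw [augment_succ, fst_d, augment_add, augment_smul]
    refine add_mem (Submodule.smul_mono_left (Ideal.span_mono (Set.image_mono
      (Set.Iio_subset_Iio n.le_succ))) (augment_d_mem x n (fst z)))
      (Submodule.smul_mem_smul (Ideal.subset_span ⟨n, n.lt_succ_self, rfl⟩) trivial)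

/-- This computes `H_0 = M/(x)M`. If `θ ∈ (x)` and `h` is its null-homotopy, then `θ m` is the
boundary of `h m`, since `m` in degree zero is a cycle. -/
theorem base_mem_range_d_iff (x : ℕ → R) (n : ℕ) (y : M) :
    (∃ w, d M x n w = base R M n y) ↔ y ∈ Ideal.span (x '' Set.Iio n) • (⊤ : Submodule R M) := by
  constructor
  · rintro ⟨w, hw⟩
    rw [← augment_base (R := R) n y, ← hw]
    exact augment_d_mem x n w
  · intro h
    refine Submodule.smul_induction_on h (fun θ hθ m _ => ?_) ?_
    · obtain ⟨h, hh⟩ := exists_homotopy (M := M) x n hθ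
      exact ⟨h (base R M n m), by rw [map_smul, ← hh, d_base, map_zero, add_zero]⟩
    · rintro y z ⟨v, hv⟩ ⟨w, hw⟩
      exact ⟨v + w, by rw [map_add, map_add, hv, hw]⟩

theorem proj_shift (π : ℤ → M →+ M) (e : ℤ) : ∀ n p j (z : KoszulChain M n),
    proj (fun i => π (i - e)) n p j z = proj π n p (j - e) z
  | 0, p, j, z => rfl
  | n + 1, p, j, z => ext_components (by simp only [fst_proj, proj_shift π e n])
      (by simp only [snd_proj, proj_shift π e n, sub_right_comm])

end KoszulChain

/-- The additive idempotents `π j` behave like the projections onto the homogeneous parts of a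
graded module on which `x 0, …, x (n - 1)` have degree one. -/
structure IsGradingProj {R M : Type*} [CommRing R] [AddCommGroup M] [Module R M] (x : ℕ → R)
    (n : ℕ) (π : ℤ → M →+ M) : Prop where
  idem : ∀ j y, π j (π j y) = π j y
  smul : ∀ i < n, ∀ j y, π j (x i • y) = x i • π (j - 1) y

/-- The Koszul homology of `M` vanishes in homological degree `p` and internal degree `j`. -/
def KoszulVanishes {R M : Type*} [CommRing R] [AddCommGroup M] [Module R M] (x : ℕ → R) (n : ℕ)
    (π : ℤ → M →+ M) (p j : ℤ) : Prop :=
  ∀ z : KoszulChain M n, proj π n p j z = z → d M x n z = 0 → ∃ w, d M x n w = z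

variable {R M N L : Type*} [CommRing R] [AddCommGroup M] [Module R M] [AddCommGroup N] [Module R N]
  [AddCommGroup L] [Module R L] {x : ℕ → R} {n : ℕ} {π : ℤ → M →+ M} {ρ : ℤ → N →+ N}
  {σ : ℤ → L →+ L} {p j : ℤ}

/-- The constant identity family forgets the internal grading. Thus ungraded statements about depth
and graded ones about regularity are instances of the same lemmas. -/
theorem isGradingProj_id : IsGradingProj (M := M) x n fun _ => AddMonoidHom.id M :=
  ⟨fun _ _ => rfl, fun _ _ _ _ => rfl⟩

theorem IsGradingProj.shift (h : IsGradingProj x n π) (e : ℤ) :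
    IsGradingProj x n fun i => π (i - e) :=
  ⟨fun j y => h.idem _ y, fun i hi j y => by rw [h.smul i hi, sub_right_comm]⟩

theorem koszulVanishes_shift {e : ℤ} :
    KoszulVanishes x n (fun i => π (i - e)) p j ↔ KoszulVanishes x n π p (j - e) := by
  simp only [KoszulVanishes, proj_shift]

theorem KoszulVanishes.of_addEquiv {S M' : Type*} [CommRing S] [AddCommGroup M'] [Module S M']
    {x' : ℕ → S} {π' : ℤ → M' →+ M'} (e : M ≃+ M') (hx : ∀ i < n, ∀ y, e (x i • y) = x' i • e y)
    (hπ : ∀ j y, e (π j y) = π' j (e y)) (h : KoszulVanishes x n π p j) :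
    KoszulVanishes x' n π' p j := by
  intro z hz hdz
  obtain ⟨y, rfl⟩ := map_surjective (f := e.toAddMonoidHom) e.surjective n z
  have inj := map_injective (f := e.toAddMonoidHom) e.injective n
  rw [← map_proj (f := e.toAddMonoidHom) hπ] at hz
  rw [← map_d (f := e.toAddMonoidHom) n hx] at hdz
  obtain ⟨w, hw⟩ := h y (inj hz) (inj (hdz.trans (map_zero _).symm))
  exact ⟨KoszulChain.map e.toAddMonoidHom n w, by
    rw [← map_d (f := e.toAddMonoidHom) n hx, hw]⟩

/-- For the constant family the internal index is immaterial, so `0` stands for all of them; the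
bounding chain need not be homogeneous. -/
theorem KoszulVanishes.of_ungraded (h : KoszulVanishes x n (fun _ => AddMonoidHom.id M) p 0) :
    KoszulVanishes x n π p j :=
  fun z hz => h z (by rw [← hz, proj_id_proj])

theorem koszulVanishes_of_neg (hp : p < 0) : KoszulVanishes x n π p j :=
  fun z hz _ => ⟨0, by rw [← hz, proj_of_neg n hp, map_zero]⟩

theorem koszulVanishes_of_gt (hp : (n : ℤ) < p) : KoszulVanishes x n π p j :=
  fun z hz _ => ⟨0, by rw [← hz, proj_of_gt n hp, map_zero]⟩

theorem koszulVanishes_of_degree {c : ℤ} (hπ : ∀ j, c < j → π j = 0) (h : c < j - p) :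
    KoszulVanishes x n π p j :=
  fun z hz _ => ⟨0, by rw [← hz, proj_eq_zero hπ n h, map_zero]⟩

/-- Koszul homology in the top homological degree is the socle. -/
theorem KoszulVanishes.eq_zero_of_smul_eq_zero (hπ : IsGradingProj x n π)
    (h : KoszulVanishes x n π n (j + n)) {y : M} (hy : π j y = y) (hxy : ∀ i < n, x i • y = 0) :
    y = 0 := by
  obtain ⟨w, hw⟩ := h (top R M n y) (by rw [proj_top, hy]) (d_top x n hxy)
  -- Nothing bounds in degree `n`: the part of `w` that would map there has homological degree `n +
  -- 1`, hence is zero.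
  have h₁ := d_proj n hπ.smul (n + 1) (j + n) w
  rw [hw, add_sub_cancel_right, proj_top, hy, proj_of_gt n (by omega), map_zero] at h₁
  exact top_injective (R := R) n (h₁.symm.trans (map_zero _).symm)

theorem koszulVanishes_zero_iff (hπ : IsGradingProj x n π) : KoszulVanishes x n π 0 j ↔
    ∀ y, π j y = y → y ∈ Ideal.span (x '' Set.Iio n) • (⊤ : Submodule R M) := by
  constructor
  · intro h y hy
    rw [← base_mem_range_d_iff]
    exact h _ (by rw [proj_zero_left (R := R), augment_base, hy]) (d_base x n y)
  · intro h z hz _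
    rw [← hz, proj_zero_left (R := R), base_mem_range_d_iff]
    exact h _ (hπ.idem _ _)

section Exact

variable {f : N →ₗ[R] M} {g : M →ₗ[R] L}

/-- Exactness of `H_p(M) → H_p(L) → H_{p-1}(N)`, chased by hand; after each lift the chain is
projected back to its bidegree. -/
theorem KoszulVanishes.cokernel (hρ : IsGradingProj x n ρ) (hπ : IsGradingProj x n π)
    (hf : Function.Injective f) (hfg : Function.Exact f g) (hg : Function.Surjective g)
    (hfπ : ∀ j y, f (ρ j y) = π j (f y)) (hgπ : ∀ j y, g (π j y) = σ j (g y))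
    (hM : KoszulVanishes x n π p j) (hN : KoszulVanishes x n ρ (p - 1) j) :
    KoszulVanishes x n σ p j := by
  intro z hz hdz
  have fd := map_d (f := f.toAddMonoidHom) (x := x) (y := x) n fun i _ m => f.map_smul (x i) m
  have gd := map_d (f := g.toAddMonoidHom) (x := x) (y := x) n fun i _ m => g.map_smul (x i) m
  have fπ := map_proj (f := f.toAddMonoidHom) hfπ
  have gπ := map_proj (f := g.toAddMonoidHom) hgπ
  have ex := map_exact (f := f.toAddMonoidHom) (g := g.toAddMonoidHom) hfg n
  have finj := map_injective (f := f.toAddMonoidHom) hf n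
  obtain ⟨u₀, hu₀⟩ := map_surjective (f := g.toAddMonoidHom) hg n z
  obtain ⟨u, hu, huz⟩ : ∃ u, proj π n p j u = u ∧ KoszulChain.map g.toAddMonoidHom n u = z :=
    ⟨_, proj_proj hπ.idem n p j u₀, by rw [gπ, hu₀, hz]⟩
  obtain ⟨w₀, hw₀⟩ := (ex (d M x n u)).1 (by rw [gd, huz, hdz])
  obtain ⟨w, hw, hwu⟩ : ∃ w, proj ρ n (p - 1) j w = w ∧
      KoszulChain.map f.toAddMonoidHom n w = d M x n u :=
    ⟨_, proj_proj hρ.idem n (p - 1) j w₀, by rw [fπ, hw₀, ← d_proj n hπ.smul, hu]⟩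
  obtain ⟨v₀, hv₀⟩ := hN w hw (finj (by rw [fd, hwu, d_d, map_zero]))
  obtain ⟨v, hv, hvw⟩ : ∃ v, proj ρ n p j v = v ∧ d N x n v = w :=
    ⟨_, proj_proj hρ.idem n p j v₀, by rw [d_proj n hρ.smul, hv₀, hw]⟩
  obtain ⟨s, hs⟩ := hM (u - KoszulChain.map f.toAddMonoidHom n v)
    (by rw [map_sub, hu, ← fπ, hv]) (by rw [map_sub, ← fd, hvw, hwu, sub_self])
  refine ⟨KoszulChain.map g.toAddMonoidHom n s, ?_⟩
  rw [← gd, hs, map_sub, huz, (ex _).2 ⟨v, rfl⟩, sub_zero]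

/-- Exactness of `H_p(L) → H_{p-1}(N) → H_{p-1}(M)`, where `hN` says that the second map is zero. -/
theorem KoszulVanishes.kernel (hπ : IsGradingProj x n π)
    (hf : Function.Injective f) (hfg : Function.Exact f g)
    (hfπ : ∀ j y, f (ρ j y) = π j (f y)) (hgπ : ∀ j y, g (π j y) = σ j (g y))
    (hL : KoszulVanishes x n σ p j)
    (hN : ∀ z, proj ρ n (p - 1) j z = z → d N x n z = 0 →
      ∃ u, d M x n u = KoszulChain.map f.toAddMonoidHom n z)
    (hg : Function.Surjective g) :
    KoszulVanishes x n ρ (p - 1) j := by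
  intro z hz hdz
  have fd := map_d (f := f.toAddMonoidHom) (x := x) (y := x) n fun i _ m => f.map_smul (x i) m
  have gd := map_d (f := g.toAddMonoidHom) (x := x) (y := x) n fun i _ m => g.map_smul (x i) m
  have fπ := map_proj (f := f.toAddMonoidHom) hfπ
  have gπ := map_proj (f := g.toAddMonoidHom) hgπ
  have ex := map_exact (f := f.toAddMonoidHom) (g := g.toAddMonoidHom) hfg n
  have finj := map_injective (f := f.toAddMonoidHom) hf n
  obtain ⟨u₀, hu₀⟩ := hN z hz hdz
  obtain ⟨u, hu, huz⟩ : ∃ u, proj π n p j u = u ∧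
      d M x n u = KoszulChain.map f.toAddMonoidHom n z :=
    ⟨_, proj_proj hπ.idem n p j u₀, by rw [d_proj n hπ.smul, hu₀, ← fπ, hz]⟩
  obtain ⟨c, hc⟩ := hL (KoszulChain.map g.toAddMonoidHom n u) (by rw [← gπ, hu])
    (by rw [← gd, huz, (ex _).2 ⟨z, rfl⟩])
  obtain ⟨c', rfl⟩ := map_surjective (f := g.toAddMonoidHom) hg n c
  obtain ⟨w, hw⟩ := (ex (u - d M x n c')).1 (by rw [map_sub, gd, hc, sub_self])
  exact ⟨w, finj (by rw [fd, hw, map_sub, d_d, sub_zero, huz])⟩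

end Exact

section Regular

variable {θ : R} {e : ℤ} {g : M →ₗ[R] L}

/-- Koszul homology of the quotient by a regular homogeneous element of the ideal `(x)`. -/
theorem koszulVanishes_quotient_iff (hπ : IsGradingProj x n π)
    (hθ : θ ∈ Ideal.span (x '' Set.Iio n)) (hreg : IsSMulRegular M θ)
    (hθπ : ∀ j y, π j (θ • y) = θ • π (j - e) y)
    (hex : Function.Exact (fun y : M => θ • y) g) (hg : Function.Surjective g)
    (hgπ : ∀ j y, g (π j y) = σ j (g y)) :
    KoszulVanishes x n σ p j ↔
      KoszulVanishes x n π p j ∧ KoszulVanishes x n π (p - 1) (j - e) := by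
  -- By this homotopy `θ` acts as zero on homology, so the long exact sequence of `0 → M(-e) → M → L
  -- → 0` splits into short ones `0 → H_p(M) → H_p(L) → H_{p-1}(M)(-e) → 0`.
  obtain ⟨h, hh⟩ := exists_homotopy (M := M) x n hθ
  let f : M →ₗ[R] M := LinearMap.lsmul R M θ
  have fsm : ∀ z, KoszulChain.map f.toAddMonoidHom n z = θ • z := map_lsmul θ n
  have gd := map_d (f := g.toAddMonoidHom) (x := x) (y := x) n fun i _ m => g.map_smul (x i) m
  have gπ := map_proj (f := g.toAddMonoidHom) hgπ
  have ex := map_exact (f := f.toAddMonoidHom) (g := g.toAddMonoidHom) hex n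
  have inj := map_injective (f := f.toAddMonoidHom) hreg n
  have gsurj := map_surjective (f := g.toAddMonoidHom) hg n
  have hfπ : ∀ j y, f (π (j - e) y) = π j (f y) := fun j y => (hθπ j y).symm
  constructor
  · intro hL
    constructor
    · intro z hz hdz
      obtain ⟨c, hc⟩ := hL (KoszulChain.map g.toAddMonoidHom n z) (by rw [← gπ, hz])
        (by rw [← gd, hdz, map_zero])
      obtain ⟨c', rfl⟩ := gsurj c
      obtain ⟨w, hw⟩ := (ex (z - d M x n c')).1 (by rw [map_sub, gd, hc, sub_self])
      rw [fsm] at hw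
      have hdw : d M x n w = 0 := inj (by
        rw [fsm, fsm, ← map_smul, hw, map_sub, hdz, d_d, sub_zero, smul_zero])
      -- Here `z = d c' + θ w` with `w` a cycle, and the homotopy gives `θ w = d (h w)`.
      refine ⟨c' + h w, ?_⟩
      have := hh w
      rw [hdw, map_zero, add_zero, hw] at this
      rw [map_add, this, add_sub_cancel]
    · rw [← koszulVanishes_shift]
      refine KoszulVanishes.kernel (f := f) hπ hreg hex hfπ hgπ hL (fun z _ hdz => ⟨h z, ?_⟩) hg
      have := hh z
      rw [hdz, map_zero, add_zero] at this
      rw [this, fsm]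
  · rintro ⟨h₁, h₂⟩
    rw [← koszulVanishes_shift] at h₂
    exact KoszulVanishes.cokernel (f := f) (hπ.shift e) hπ hreg hex hg hfπ hgπ h₁ h₂

end Regular

/-- Sequences that are regular up to their last quotient have an acyclic Koszul complex. -/
theorem koszulVanishes_of_regular
    (h : ∀ m < n, ∀ y : M, x m • y ∈ Ideal.span (x '' Set.Iio m) • (⊤ : Submodule R M) →
      y ∈ Ideal.span (x '' Set.Iio m) • (⊤ : Submodule R M)) (hp : 0 < p) :
    KoszulVanishes x n (fun _ => AddMonoidHom.id M) p 0 := by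
  induction n generalizing p with
  | zero => exact koszulVanishes_of_gt (by simpa using hp)
  | succ n ih =>
    intro z hz hdz
    have ih' := fun q hq => ih (p := q) (fun m hm => h m (hm.trans n.lt_succ_self)) hq
    have h₁ : d M x n (fst z) + x n • snd z = 0 := congrArg fst hdz
    have h₂ : d M x n (snd z) = 0 := neg_eq_zero.1 (congrArg snd hdz)
    have hz₁ : proj (fun _ => AddMonoidHom.id M) n p 0 (fst z) = fst z := congrArg fst hz
    have hz₂ : proj (fun _ => AddMonoidHom.id M) n (p - 1) (0 - 1) (snd z) = snd z :=
      congrArg snd hz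
    -- The second component is a cycle of degree `p - 1`. For `p - 1 > 0` induction applies; for `p
    -- - 1 = 0` its multiple by `x n` is a boundary, and regularity of `x n` modulo the earlier
    -- elements removes the factor.
    obtain ⟨c₀, hc₀⟩ : ∃ c, d M x n c = snd z := by
      rcases (show 0 ≤ p - 1 by omega).eq_or_lt with hp' | hp'
      · rw [← hp', proj_zero_left (R := R)] at hz₂
        rw [← hz₂, base_mem_range_d_iff]
        refine h n n.lt_succ_self _ ?_
        rw [← base_mem_range_d_iff, map_smul, hz₂]
        exact ⟨-fst z, by rw [map_neg, neg_eq_iff_add_eq_zero, h₁]⟩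
      · refine ih' (p - 1) hp' (snd z) ?_ h₂
        rw [← hz₂, proj_id_proj]
    obtain ⟨c, hc, hcz⟩ : ∃ c, proj (fun _ => AddMonoidHom.id M) n p 0 c = c ∧
        d M x n c = snd z := by
      refine ⟨_, proj_proj (fun _ _ => rfl) n p 0 c₀, ?_⟩
      rw [d_proj n (fun _ _ _ _ => rfl), hc₀, ← hz₂, proj_id_proj]
    obtain ⟨a, ha⟩ := ih' p hp (fst z + x n • c)
      (by rw [map_add, hz₁, proj_smul (e := 0) (fun _ _ => rfl), sub_zero, hc])
      (by rw [map_add, map_smul, hcz, h₁])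
    refine ⟨mk a (-c), ext_components ?_ ?_⟩
    · rw [fst_d, fst_mk, snd_mk, ha, smul_neg, add_neg_cancel_right]
    · rw [snd_d, snd_mk, map_neg, neg_neg, hcz]

end KoszulVanishing

/-! ### Homogeneous projections with integer indices -/

section GradedProj

variable {K A : Type*} [CommRing K] [CommRing A] [Algebra K A] (𝒜 : ℕ → Submodule K A)
  [GradedAlgebra 𝒜]

/-- The projection to the part of degree `j` of an `ℕ`-graded algebra, for an integer `j`. -/
def gradedProj (j : ℤ) : A →ₗ[K] A :=
  if 0 ≤ j then GradedAlgebra.proj 𝒜 j.toNat else 0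

theorem gradedProj_natCast (i : ℕ) (a : A) :
    gradedProj 𝒜 i a = (DirectSum.decompose 𝒜 a i : A) := by
  rw [gradedProj, if_pos (Int.natCast_nonneg i), Int.toNat_natCast, GradedAlgebra.proj_apply]

theorem gradedProj_of_neg {j : ℤ} (hj : j < 0) : gradedProj 𝒜 j = 0 :=
  if_neg (not_le.2 hj)

variable {𝒜}

theorem gradedProj_natCast_mem (i : ℕ) (a : A) : gradedProj 𝒜 i a ∈ 𝒜 i := by
  rw [gradedProj_natCast]
  exact (DirectSum.decompose 𝒜 a i).2

theorem gradedProj_of_mem {i : ℕ} {a : A} (ha : a ∈ 𝒜 i) (j : ℤ) :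
    gradedProj 𝒜 j a = if j = i then a else 0 := by
  rcases lt_or_ge j 0 with hj | hj
  · rw [gradedProj_of_neg 𝒜 hj, if_neg (by omega)]
    rfl
  · lift j to ℕ using hj
    rw [gradedProj_natCast]
    split_ifs with h
    · obtain rfl : j = i := by exact_mod_cast h
      exact DirectSum.decompose_of_mem_same 𝒜 ha
    · exact DirectSum.decompose_of_mem_ne 𝒜 ha (by rintro rfl; exact h rfl)

theorem gradedProj_of_mem_same {i : ℕ} {a : A} (ha : a ∈ 𝒜 i) : gradedProj 𝒜 i a = a := by
  rw [gradedProj_of_mem ha, if_pos rfl]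

theorem gradedProj_idem (j : ℤ) (a : A) :
    gradedProj 𝒜 j (gradedProj 𝒜 j a) = gradedProj 𝒜 j a := by
  rcases lt_or_ge j 0 with hj | hj
  · rw [gradedProj_of_neg 𝒜 hj]
    rfl
  · lift j to ℕ using hj
    exact gradedProj_of_mem_same (gradedProj_natCast_mem j a)

theorem gradedProj_mul {e : ℕ} {a : A} (ha : a ∈ 𝒜 e) (j : ℤ) (b : A) :
    gradedProj 𝒜 j (a * b) = a * gradedProj 𝒜 (j - e) b := by
  rcases lt_or_ge j 0 with hj | hj
  · rw [gradedProj_of_neg 𝒜 hj, gradedProj_of_neg 𝒜 (show j - e < 0 by omega)]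
    simp
  · lift j to ℕ using hj
    rw [gradedProj_natCast]
    by_cases h : e ≤ j
    · rw [DirectSum.coe_decompose_mul_of_left_mem_of_le 𝒜 ha h, ← Nat.cast_sub h,
        gradedProj_natCast]
    · rw [DirectSum.coe_decompose_mul_of_left_mem_of_not_le 𝒜 ha h,
        gradedProj_of_neg 𝒜 (show (j : ℤ) - e < 0 by omega)]
      simp

theorem gradedProj_map {B : Type*} [CommRing B] [Algebra K B] {ℬ : ℕ → Submodule K B}
    [GradedAlgebra ℬ] {f : A →ₗ[K] B} (hf : ∀ i, ∀ a ∈ 𝒜 i, f a ∈ ℬ i) (j : ℤ) (a : A) :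
    f (gradedProj 𝒜 j a) = gradedProj ℬ j (f a) := by
  induction a using DirectSum.Decomposition.inductionOn 𝒜 with
  | zero => simp only [map_zero]
  | @homogeneous i a =>
    rw [gradedProj_of_mem a.2, gradedProj_of_mem (hf i a a.2), apply_ite f, map_zero]
  | add a b ha hb => simp only [map_add, ha, hb]

end GradedProj

/-! ### Shifts of a minimal resolution as degrees of Koszul homology -/

section MinimalResolution

open MvPolynomial KoszulChain

attribute [local instance] MvPolynomial.gradedAlgebra

/-- A finite sequence, extended by zero. -/
def extendByZero {R : Type*} [Zero R] {n : ℕ} (x : Fin n → R) (i : ℕ) : R :=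
  if h : i < n then x ⟨i, h⟩ else 0

theorem extendByZero_val {R : Type*} [Zero R] {n : ℕ} (x : Fin n → R) (i : Fin n) :
    extendByZero x i = x i := dif_pos i.2

theorem extendByZero_image_Iio {R : Type*} [Zero R] {n m : ℕ} (x : Fin n → R) (hm : m ≤ n) :
    extendByZero x '' Set.Iio m = x '' {i | (i : ℕ) < m} := by
  ext y
  constructor
  · rintro ⟨i, hi, rfl⟩
    exact ⟨⟨i, lt_of_lt_of_le hi hm⟩, hi, (extendByZero_val x ⟨i, lt_of_lt_of_le hi hm⟩).symm⟩
  · rintro ⟨i, hi, rfl⟩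
    exact ⟨i, hi, extendByZero_val x i⟩

theorem extendByZero_image_Iio_self {R : Type*} [Zero R] {n : ℕ} (x : Fin n → R) :
    extendByZero x '' Set.Iio n = Set.range x := by
  rw [extendByZero_image_Iio x le_rfl, show {i : Fin n | (i : ℕ) < n} = Set.univ from
    Set.eq_univ_of_forall fun i => i.2, Set.image_univ]

theorem mem_ideal_smul_top_pi_iff {R : Type*} [CommRing R] {r : ℕ} (I : Ideal R) (y : Fin r → R) :
    y ∈ I • (⊤ : Submodule R (Fin r → R)) ↔ ∀ k, y k ∈ I := by
  constructor
  · intro h k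
    refine Submodule.smul_induction_on h (fun a ha z _ => I.mul_mem_right _ ha) ?_
    exact fun a b ha hb => I.add_mem ha hb
  · intro h
    rw [pi_eq_sum_univ' y]
    exact Submodule.sum_mem _ fun k _ => Submodule.smul_mem_smul (h k) trivial

variable {K : Type*} [Field K] {n : ℕ}

theorem mem_span_range_X_iff (f : MvPolynomial (Fin n) K) :
    f ∈ Ideal.span (Set.range (X : Fin n → MvPolynomial (Fin n) K)) ↔ constantCoeff f = 0 := by
  rw [← Set.image_univ, mem_ideal_span_X_image]
  constructor
  · intro h
    by_contra h'
    obtain ⟨i, _, hi⟩ := h 0 (mem_support_iff.2 h')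
    exact hi rfl
  · intro h m hm
    by_contra! h'
    obtain rfl : m = 0 := Finsupp.ext fun i => h' i trivial
    exact mem_support_iff.1 hm h

/-- The variables form a regular sequence: membership in an ideal generated by variables is tested
monomial by monomial. -/
theorem mem_span_X_image_of_X_mul_mem {S : Set (Fin n)} {i : Fin n} (hi : i ∉ S)
    {f : MvPolynomial (Fin n) K}
    (h : X i * f ∈ Ideal.span ((X : Fin n → MvPolynomial (Fin n) K) '' S)) :
    f ∈ Ideal.span ((X : Fin n → MvPolynomial (Fin n) K) '' S) := by
  rw [mem_ideal_span_X_image] at h ⊢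
  intro m hm
  obtain ⟨l, hl, hlm⟩ := h (Finsupp.single i 1 + m)
    (by rw [mem_support_iff, coeff_X_mul]; exact mem_support_iff.1 hm)
  refine ⟨l, hl, ?_⟩
  rwa [Finsupp.add_apply, Finsupp.single_eq_of_ne (by rintro rfl; exact hi hl), zero_add] at hlm

theorem constantCoeff_gradedProj_of_ne {j : ℤ} (hj : j ≠ 0) (f : MvPolynomial (Fin n) K) :
    constantCoeff (gradedProj (homogeneousSubmodule (Fin n) K) j f) = 0 := by
  rcases lt_or_ge j 0 with h | h
  · rw [gradedProj_of_neg _ h, LinearMap.zero_apply, map_zero]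
  · lift j to ℕ using h
    have := gradedProj_natCast_mem (𝒜 := homogeneousSubmodule (Fin n) K) j f
    exact ((mem_homogeneousSubmodule j _).1 this).coeff_eq_zero (d := 0) (by
      rw [map_zero]
      exact_mod_cast hj.symm)

theorem gradedProj_zero_eq_C (f : MvPolynomial (Fin n) K) :
    gradedProj (homogeneousSubmodule (Fin n) K) 0 f = C (constantCoeff f) := by
  have h := gradedProj_natCast (homogeneousSubmodule (Fin n) K) 0 f
  rw [Nat.cast_zero] at h
  have h' : (DirectSum.decompose (homogeneousSubmodule (Fin n) K) f 0 : MvPolynomial (Fin n) K) =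
      homogeneousComponent 0 f := decomposition.decompose'_apply f 0
  rw [h, h', homogeneousComponent_zero]
  rfl

/-- The projections of the graded free module `⨁ k, R(-shift k)`. -/
noncomputable def freeProj (K : Type*) [Field K] (n : ℕ) {r : ℕ} (shift : Fin r → ℕ) (j : ℤ) :
    (Fin r → MvPolynomial (Fin n) K) →+ (Fin r → MvPolynomial (Fin n) K) where
  toFun f k := gradedProj (homogeneousSubmodule (Fin n) K) (j - shift k) (f k)
  map_zero' := funext fun _ => map_zero _
  map_add' _ _ := funext fun _ => map_add _ _ _

theorem freeProj_apply {r : ℕ} (shift : Fin r → ℕ) (j : ℤ) (f : Fin r → MvPolynomial (Fin n) K)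
    (k : Fin r) : freeProj K n shift j f k =
      gradedProj (homogeneousSubmodule (Fin n) K) (j - shift k) (f k) := rfl

theorem X_mem_homogeneousSubmodule (i : Fin n) :
    (X i : MvPolynomial (Fin n) K) ∈ homogeneousSubmodule (Fin n) K 1 :=
  (mem_homogeneousSubmodule 1 _).2 (isHomogeneous_X K i)

theorem isGradingProj_freeProj {r : ℕ} (shift : Fin r → ℕ) :
    IsGradingProj (extendByZero (X : Fin n → MvPolynomial (Fin n) K)) n
      (freeProj K n shift) where
  idem j y := funext fun k => gradedProj_idem _ _
  smul i hi j y := funext fun k => by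
    rw [extendByZero_val X ⟨i, hi⟩, freeProj_apply, Pi.smul_apply, Pi.smul_apply, smul_eq_mul,
      smul_eq_mul, gradedProj_mul (X_mem_homogeneousSubmodule _), freeProj_apply, Nat.cast_one,
      sub_right_comm]

theorem mulVec_freeProj {r s : ℕ} {shift : Fin r → ℕ} {shift' : Fin s → ℕ}
    {D : Matrix (Fin r) (Fin s) (MvPolynomial (Fin n) K)}
    (hD : ∀ k l, D k l ≠ 0 → ∃ e : ℕ, shift k + e = shift' l ∧ (D k l).IsHomogeneous e)
    (j : ℤ) (f : Fin s → MvPolynomial (Fin n) K) :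
    D.mulVec (freeProj K n shift' j f) = freeProj K n shift j (D.mulVec f) := by
  ext1 k
  rw [freeProj_apply, Matrix.mulVec_eq_sum, Matrix.mulVec_eq_sum, Finset.sum_apply,
    Finset.sum_apply, map_sum]
  refine Finset.sum_congr rfl fun l _ => ?_
  simp only [Pi.smul_apply, MulOpposite.smul_eq_mul_unop, MulOpposite.unop_op, freeProj_apply,
    Matrix.transpose_apply]
  by_cases h : D k l = 0
  · rw [h, zero_mul, zero_mul, map_zero]
  · obtain ⟨e, he, hom⟩ := hD k l h
    rw [gradedProj_mul ((mem_homogeneousSubmodule e _).2 hom)]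
    congr 3
    omega

theorem koszulVanishes_free {r : ℕ} {p : ℤ} (hp : 0 < p) :
    KoszulVanishes (M := Fin r → MvPolynomial (Fin n) K)
      (extendByZero (X : Fin n → MvPolynomial (Fin n) K)) n (fun _ => AddMonoidHom.id _) p 0 := by
  refine koszulVanishes_of_regular (fun m hm y hy => ?_) hp
  rw [extendByZero_image_Iio _ hm.le, mem_ideal_smul_top_pi_iff] at hy ⊢
  intro k
  have := hy k
  rw [extendByZero_val X ⟨m, hm⟩, Pi.smul_apply, smul_eq_mul] at this
  exact mem_span_X_image_of_X_mul_mem (fun h => lt_irrefl m h) this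

section Syzygy

variable {N L : Type*} [AddCommGroup N] [Module (MvPolynomial (Fin n) K) N]
  [AddCommGroup L] [Module (MvPolynomial (Fin n) K) L] {r : ℕ} {shift : Fin r → ℕ}
  {ρ : ℤ → N →+ N} {σ : ℤ → L →+ L} {p j : ℤ}
  {f : N →ₗ[MvPolynomial (Fin n) K] (Fin r → MvPolynomial (Fin n) K)}
  {g : (Fin r → MvPolynomial (Fin n) K) →ₗ[MvPolynomial (Fin n) K] L}

theorem map_base {R M M' : Type*} [CommRing R] [AddCommGroup M] [Module R M] [AddCommGroup M']
    [Module R M'] (f : M →ₗ[R] M') : ∀ m (y : M),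
      KoszulChain.map f.toAddMonoidHom m (base R M m y) = base R M' m (f y)
  | 0, _ => rfl
  | m + 1, y => ext_components (map_base f m y) (map_zero _)

/-- Koszul homology of a module and of its first syzygy. -/
theorem koszulVanishes_syzygy_iff
    (hρ : IsGradingProj (extendByZero (X : Fin n → MvPolynomial (Fin n) K)) n ρ)
    (hf : Function.Injective f) (hfg : Function.Exact f g) (hg : Function.Surjective g)
    (hfρ : ∀ j y, f (ρ j y) = freeProj K n shift j (f y))
    (hgσ : ∀ j y, g (freeProj K n shift j y) = σ j (g y))
    (hmin : ∀ y k, constantCoeff (f y k) = 0) (hp : 0 < p) :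
    KoszulVanishes (extendByZero (X : Fin n → MvPolynomial (Fin n) K)) n σ p j ↔
      KoszulVanishes (extendByZero (X : Fin n → MvPolynomial (Fin n) K)) n ρ (p - 1) j := by
  have hfree := isGradingProj_freeProj (K := K) (n := n) shift
  constructor
  · intro h
    refine KoszulVanishes.kernel hfree hf hfg hfρ hgσ h (fun z hz hdz => ?_) hg
    -- The map `H_{p-1}(N) → H_{p-1}(F)` is zero: in degree zero because minimality puts the image
    -- of `N` in `(X)F`, in positive degrees because `F` is acyclic.
    rcases (show 0 ≤ p - 1 by omega).eq_or_lt with hp' | hp'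
    · rw [← hp', proj_zero_left (R := MvPolynomial (Fin n) K)] at hz
      rw [← hz, map_base, base_mem_range_d_iff, extendByZero_image_Iio_self,
        mem_ideal_smul_top_pi_iff]
      exact fun k => (mem_span_range_X_iff _).2 (hmin _ k)
    · refine koszulVanishes_free hp' _ ?_ ?_
      · rw [← hz, map_proj hfρ, proj_id_proj]
      · rw [← map_d (f := f.toAddMonoidHom) n fun i _ m => f.map_smul _ m, hdz, map_zero]
  · exact fun h => KoszulVanishes.cokernel hρ hfree hf hfg hg hfρ hgσ
      (koszulVanishes_free hp).of_ungraded h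

/-- Minimality makes `F/(X)F → L/(X)L` an isomorphism, so the degrees of a basis of `F` are the
degrees in which `L/(X)L` is nonzero. -/
theorem koszulVanishes_zero_iff_shift
    (hσ : IsGradingProj (extendByZero (X : Fin n → MvPolynomial (Fin n) K)) n σ)
    (hg : Function.Surjective g)
    (hgσ : ∀ j y, g (freeProj K n shift j y) = σ j (g y))
    (hmin : ∀ y, g y = 0 → ∀ k, constantCoeff (y k) = 0) :
    KoszulVanishes (extendByZero (X : Fin n → MvPolynomial (Fin n) K)) n σ 0 j ↔
      ∀ k, (shift k : ℤ) ≠ j := by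
  rw [koszulVanishes_zero_iff hσ, extendByZero_image_Iio_self]
  set I := Ideal.span (Set.range (X : Fin n → MvPolynomial (Fin n) K)) with hI
  have hmap : I • (⊤ : Submodule (MvPolynomial (Fin n) K) L) = (I • ⊤ : Submodule _ _).map g := by
    rw [Submodule.map_smul'', Submodule.map_top, LinearMap.range_eq_top.2 hg]
  constructor
  · rintro h k rfl
    have hk := h (g (Pi.single k 1)) (by
      rw [← hgσ]
      congr 1
      ext1 l
      rw [freeProj_apply]
      by_cases hl : l = k
      · subst hl
        rw [Pi.single_eq_same, sub_self]
        exact gradedProj_of_mem_same ((mem_homogeneousSubmodule 0 _).2 (isHomogeneous_one _ _))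
      · rw [Pi.single_eq_of_ne hl, map_zero])
    rw [hmap] at hk
    obtain ⟨y, hy, hyk⟩ := hk
    have h₁ := hmin (Pi.single k 1 - y) (by rw [map_sub, hyk, sub_self]) k
    have h₂ := (mem_span_range_X_iff _).1 ((mem_ideal_smul_top_pi_iff I y).1 hy k)
    rw [Pi.sub_apply, map_sub, h₂, Pi.single_eq_same, map_one, sub_zero] at h₁
    exact one_ne_zero h₁
  · intro h y hy
    obtain ⟨u, rfl⟩ := hg y
    rw [hmap, ← hy, ← hgσ]
    refine Submodule.mem_map_of_mem ((mem_ideal_smul_top_pi_iff I _).2 fun k => ?_)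
    rw [mem_span_range_X_iff, freeProj_apply]
    exact constantCoeff_gradedProj_of_ne (fun h' => h k (by omega)) _

end Syzygy

variable {A : Type*} [CommRing A] [Algebra K A] {𝒜 : ℕ → Submodule K A}
  {x : Fin n → A}

theorem aeval_mem_of_isHomogeneous [GradedAlgebra 𝒜] (hx : ∀ i, x i ∈ 𝒜 1) {e : ℕ}
    {f : MvPolynomial (Fin n) K} (hf : f ∈ homogeneousSubmodule (Fin n) K e) :
    aeval x f ∈ 𝒜 e := by
  rw [f.as_sum, map_sum]
  refine Submodule.sum_mem _ fun m hm => ?_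
  rw [aeval_monomial, ← Algebra.smul_def]
  refine Submodule.smul_mem _ _ ?_
  have hdeg : m.sum (fun _ k => k • 1) = e := by
    have := (mem_homogeneousSubmodule e f).1 hf (mem_support_iff.1 hm)
    rw [← this, Finsupp.weight_apply]
    rfl
  rw [← hdeg]
  exact SetLike.prod_mem_graded _ _ _ fun i _ => SetLike.pow_mem_graded _ (hx i)

theorem aeval_gradedProj [GradedAlgebra 𝒜] (hx : ∀ i, x i ∈ 𝒜 1) (j : ℤ)
    (f : MvPolynomial (Fin n) K) :
    aeval x (gradedProj (homogeneousSubmodule (Fin n) K) j f) = gradedProj 𝒜 j (aeval x f) :=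
  gradedProj_map (f := (aeval x).toLinearMap) (fun _ _ h => aeval_mem_of_isHomogeneous hx h) j f

/-- The projections of a graded algebra, as additive maps. -/
def gradedAddProj (𝒜 : ℕ → Submodule K A) [GradedAlgebra 𝒜] (j : ℤ) : A →+ A :=
  (gradedProj 𝒜 j).toAddMonoidHom

namespace MinimalGradedFreeResolution

variable (P : MinimalGradedFreeResolution 𝒜 x)

/-- The differential `F_{i+1} → F_i`. -/
noncomputable def diffMap (i : ℕ) :
    (Fin (P.rank (i + 1)) → MvPolynomial (Fin n) K) →ₗ[MvPolynomial (Fin n) K]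
      (Fin (P.rank i) → MvPolynomial (Fin n) K) := (P.diff i).mulVecLin

theorem diffMap_apply (i : ℕ) (f) (k : Fin (P.rank i)) :
    P.diffMap i f k = ∑ l, P.diff i k l * f l := rfl

theorem diffMap_freeProj (i : ℕ) (j : ℤ) (f) :
    P.diffMap i (freeProj K n (P.shift (i + 1)) j f) =
      freeProj K n (P.shift i) j (P.diffMap i f) :=
  mulVec_freeProj (P.diff_homogeneous i) j f

theorem constantCoeff_diffMap (i : ℕ) (f) (k : Fin (P.rank i)) :
    constantCoeff (P.diffMap i f k) = 0 := by
  rw [diffMap_apply, map_sum]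
  exact Finset.sum_eq_zero fun l _ => by rw [map_mul, P.minimal, zero_mul]

/-- The image of `F_{i+1} → F_i`. -/
noncomputable abbrev syzygy (i : ℕ) :
    Submodule (MvPolynomial (Fin n) K) (Fin (P.rank i) → MvPolynomial (Fin n) K) :=
  LinearMap.range (P.diffMap i)

noncomputable def syzygyProj (i : ℕ) (j : ℤ) : P.syzygy i →+ P.syzygy i where
  toFun y := ⟨freeProj K n (P.shift i) j y, by
    obtain ⟨_, u, rfl⟩ := y
    exact ⟨_, P.diffMap_freeProj i j u⟩⟩
  map_zero' := Subtype.ext (map_zero _)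
  map_add' _ _ := Subtype.ext (map_add _ _ _)

theorem isGradingProj_syzygyProj (i : ℕ) :
    IsGradingProj (extendByZero (X : Fin n → MvPolynomial (Fin n) K)) n (P.syzygyProj i) where
  idem j _ := Subtype.ext ((isGradingProj_freeProj _).idem j _)
  smul i hi j _ := Subtype.ext ((isGradingProj_freeProj _).smul i hi j _)

theorem diffMap_eq_zero_iff (i : ℕ) (f) : P.diffMap i f = 0 ↔ f ∈ P.syzygy (i + 1) :=
  (P.exact_succ i f).trans ⟨fun ⟨g, h⟩ => ⟨g, h.symm⟩, fun ⟨g, h⟩ => ⟨g, h.symm⟩⟩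

/-- Dimension shifting: `H_p` of the `i`-th syzygy module is controlled by `H_0` of the `(i + p)`-th
one. As `syzygy i` lies in `F_i`, it is covered by `F_{i+1}`, whence the index `i + 1 + p`. -/
theorem koszulVanishes_syzygy (p : ℕ) : ∀ (i : ℕ) (j : ℤ),
    KoszulVanishes (extendByZero (X : Fin n → MvPolynomial (Fin n) K)) n (P.syzygyProj i) p j ↔
      ∀ k, (P.shift (i + 1 + p) k : ℤ) ≠ j := by
  induction p with
  | zero =>
    intro i j
    refine koszulVanishes_zero_iff_shift (g := (P.diffMap i).rangeRestrict)
      (P.isGradingProj_syzygyProj i) (LinearMap.surjective_rangeRestrict _)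
      (fun j y => Subtype.ext (P.diffMap_freeProj i j y)) fun y hy k => ?_
    obtain ⟨u, rfl⟩ := (P.diffMap_eq_zero_iff i y).1 (congrArg Subtype.val hy)
    exact P.constantCoeff_diffMap _ u k
  | succ p ih =>
    intro i j
    rw [koszulVanishes_syzygy_iff (f := (P.syzygy (i + 1)).subtype)
      (g := (P.diffMap i).rangeRestrict) (ρ := P.syzygyProj (i + 1)) (σ := P.syzygyProj i)
      (shift := P.shift (i + 1)) (P.isGradingProj_syzygyProj (i + 1))
      Subtype.val_injective ?_ (LinearMap.surjective_rangeRestrict _)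
      (fun _ _ => rfl) (fun j y => Subtype.ext (P.diffMap_freeProj i j y)) ?_
      (Int.natCast_pos.2 p.succ_pos)]
    · rw [Nat.cast_succ, add_sub_cancel_right, ih (i + 1) j,
        show i + 1 + 1 + p = i + 1 + (p + 1) by omega]
    · intro y
      rw [Submodule.coe_subtype, Subtype.range_coe_subtype, Set.mem_ofPred_eq,
        ← P.diffMap_eq_zero_iff]
      exact ⟨fun h => congrArg Subtype.val h, fun h => Subtype.ext h⟩
    · rintro ⟨_, u, rfl⟩ k
      exact P.constantCoeff_diffMap _ u k

/-- The shifts of a minimal resolution are the degrees of the Koszul homology. -/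
theorem koszulVanishes_iff [GradedAlgebra 𝒜] (hx : ∀ i, x i ∈ 𝒜 1) (p : ℕ) (j : ℤ) :
    KoszulVanishes (extendByZero x) n (gradedAddProj 𝒜) p j ↔ ∀ k, (P.shift p k : ℤ) ≠ j := by
  -- Through this structure `X i` and `x i` act on `A` by the same operator, so the Koszul complexes
  -- over the two rings coincide.
  let _ : Module (MvPolynomial (Fin n) K) A := Module.compHom A (aeval x).toRingHom
  have hsmul : ∀ (f : MvPolynomial (Fin n) K) (a : A), f • a = aeval x f * a := fun _ _ => rfl
  have hX : ∀ i < n, ∀ a : A, extendByZero (X : Fin n → MvPolynomial (Fin n) K) i • a =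
      extendByZero x i • a := fun i hi a => by
    rw [extendByZero_val X ⟨i, hi⟩, extendByZero_val x ⟨i, hi⟩, hsmul, aeval_X, smul_eq_mul]
  have hbridge : KoszulVanishes (extendByZero x) n (gradedAddProj 𝒜) p j ↔
      KoszulVanishes (extendByZero (X : Fin n → MvPolynomial (Fin n) K)) n
        (gradedAddProj 𝒜) p j :=
    ⟨fun h => h.of_addEquiv (AddEquiv.refl A) (fun i hi a => (hX i hi a).symm) fun _ _ => rfl,
      KoszulVanishes.of_addEquiv (x := extendByZero (X : Fin n → MvPolynomial (Fin n) K))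
        (x' := extendByZero x) (AddEquiv.refl A) hX fun _ _ => rfl⟩
  rw [hbridge]
  let g : (Fin (P.rank 0) → MvPolynomial (Fin n) K) →ₗ[MvPolynomial (Fin n) K] A :=
    { toFun := fun f => ∑ k, aeval x (f k) * P.gen k
      map_add' := fun f f' => by
        simp only [Pi.add_apply, map_add, add_mul, Finset.sum_add_distrib]
      map_smul' := fun r f => by
        simp only [Pi.smul_apply, smul_eq_mul, map_mul, RingHom.id_apply, hsmul, Finset.mul_sum,
          mul_assoc] }
  have hg : Function.Surjective g := P.surjective
  have hgπ : ∀ j y, g (freeProj K n (P.shift 0) j y) = gradedAddProj 𝒜 j (g y) := by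
    intro j y
    change ∑ k, aeval x (freeProj K n (P.shift 0) j y k) * P.gen k =
      gradedProj 𝒜 j (∑ k, aeval x (y k) * P.gen k)
    rw [map_sum]
    refine Finset.sum_congr rfl fun k _ => ?_
    rw [freeProj_apply, aeval_gradedProj hx, mul_comm _ (P.gen k), mul_comm _ (P.gen k),
      gradedProj_mul (P.gen_mem k)]
  have hker : ∀ y, g y = 0 ↔ y ∈ P.syzygy 0 := fun y =>
    (P.exact_zero y).trans ⟨fun ⟨g, h⟩ => ⟨g, h.symm⟩, fun ⟨g, h⟩ => ⟨g, h.symm⟩⟩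
  cases p with
  | zero =>
    refine koszulVanishes_zero_iff_shift (g := g) ⟨fun j a => gradedProj_idem j a, ?_⟩ hg hgπ ?_
    · intro i hi j a
      rw [hX i hi, hX i hi, extendByZero_val x ⟨i, hi⟩]
      exact gradedProj_mul (hx ⟨i, hi⟩) j a
    · intro y hy k
      obtain ⟨u, rfl⟩ := (hker y).1 hy
      exact P.constantCoeff_diffMap _ u k
  | succ p =>
    rw [koszulVanishes_syzygy_iff (f := (P.syzygy 0).subtype) (g := g) (ρ := P.syzygyProj 0)
      (shift := P.shift 0) (P.isGradingProj_syzygyProj 0) Subtype.val_injective ?_ hg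
      (fun _ _ => rfl) hgπ ?_ (by omega)]
    · rw [Nat.cast_succ, add_sub_cancel_right, P.koszulVanishes_syzygy p 0 j,
        show 0 + 1 + p = p + 1 by omega]
    · intro y
      rw [Submodule.coe_subtype, Subtype.range_coe_subtype, Set.mem_ofPred_eq, hker]
    · rintro ⟨_, u, rfl⟩ k
      exact P.constantCoeff_diffMap _ u k

end MinimalGradedFreeResolution

end MinimalResolution

/-! ### Existence of minimal graded free resolutions -/

section ResolutionExistence

open MvPolynomial

attribute [local instance] MvPolynomial.gradedAlgebra

theorem exists_sum_gradedProj_eq {K A : Type*} [CommRing K] [CommRing A] [Algebra K A]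
    (𝒜 : ℕ → Submodule K A) [GradedAlgebra 𝒜] (a : A) :
    ∃ B : ℕ, ∀ m ≥ B, ∑ i ∈ Finset.range m, gradedProj 𝒜 i a = a := by
  induction a using DirectSum.Decomposition.inductionOn 𝒜 with
  | zero => exact ⟨0, fun m _ => by simp⟩
  | @homogeneous i a =>
    refine ⟨i + 1, fun m hm => ?_⟩
    simp only [gradedProj_of_mem a.2, Nat.cast_inj]
    rw [Finset.sum_ite_eq', if_pos (Finset.mem_range.2 hm)]
  | add a b ha hb =>
    obtain ⟨B, hB⟩ := ha
    obtain ⟨C, hC⟩ := hb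
    refine ⟨max B C, fun m hm => ?_⟩
    simp only [map_add, Finset.sum_add_distrib]
    rw [hB m (le_trans (le_max_left _ _) hm), hC m (le_trans (le_max_right _ _) hm)]

variable {K : Type*} [Field K] {n r : ℕ} {shift : Fin r → ℕ}

theorem exists_sum_freeProj_eq (shift : Fin r → ℕ) (y : Fin r → MvPolynomial (Fin n) K) :
    ∃ B : ℕ, ∑ i ∈ Finset.range B, freeProj K n shift i y = y := by
  choose b hb using fun k => exists_sum_gradedProj_eq (homogeneousSubmodule (Fin n) K) (y k)
  -- Component `k` is summed with its index lowered by `shift k`, so it needs `shift k + b k` terms;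
  -- the sum bounds all of these at once.
  refine ⟨∑ k, (shift k + b k), funext fun k => ?_⟩
  have hk : shift k + b k ≤ ∑ k, (shift k + b k) :=
    Finset.single_le_sum (f := fun k => shift k + b k) (fun _ _ => Nat.zero_le _)
      (Finset.mem_univ k)
  obtain ⟨c, hc⟩ := Nat.exists_eq_add_of_le hk
  rw [Finset.sum_apply, hc, add_assoc, Finset.sum_range_add, Finset.sum_eq_zero, zero_add]
  · rw [← hb k (b k + c) (Nat.le_add_right _ _)]
    refine Finset.sum_congr rfl fun i _ => ?_
    rw [freeProj_apply]
    congr 2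
    push_cast
    ring
  · intro i hi
    rw [freeProj_apply, gradedProj_of_neg _ (by have := Finset.mem_range.1 hi; omega)]
    rfl

theorem isHomogeneous_of_freeProj_eq {d : ℕ} {y : Fin r → MvPolynomial (Fin n) K}
    (hy : freeProj K n shift d y = y) (k : Fin r) (hk : y k ≠ 0) :
    ∃ e : ℕ, shift k + e = d ∧ (y k).IsHomogeneous e := by
  have h : gradedProj (homogeneousSubmodule (Fin n) K) (d - shift k) (y k) = y k := congrFun hy k
  rcases lt_or_ge ((d : ℤ) - shift k) 0 with hj | hj
  · rw [gradedProj_of_neg _ hj] at h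
    exact absurd h.symm hk
  · obtain ⟨e, he⟩ := Int.eq_ofNat_of_zero_le hj
    refine ⟨e, by omega, ?_⟩
    rw [he] at h
    rw [← mem_homogeneousSubmodule, ← h]
    exact gradedProj_natCast_mem e _

theorem freeProj_smul_of_eq {d : ℕ} {y : Fin r → MvPolynomial (Fin n) K}
    (hy : freeProj K n shift d y = y) (j : ℤ) (c : MvPolynomial (Fin n) K) :
    freeProj K n shift j (c • y) =
      gradedProj (homogeneousSubmodule (Fin n) K) (j - d) c • y := by
  ext1 k
  rw [freeProj_apply, Pi.smul_apply, Pi.smul_apply, smul_eq_mul, smul_eq_mul]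
  by_cases hk : y k = 0
  · rw [hk, mul_zero, mul_zero, map_zero]
  · obtain ⟨e, he, hom⟩ := isHomogeneous_of_freeProj_eq hy k hk
    rw [mul_comm, gradedProj_mul ((mem_homogeneousSubmodule e _).2 hom), mul_comm]
    congr 3
    omega

/-- A graded submodule of a graded free module of finite rank has a minimal system of homogeneous
generators. -/
theorem exists_minimal_homogeneous_generators (shift : Fin r → ℕ)
    (N : Submodule (MvPolynomial (Fin n) K) (Fin r → MvPolynomial (Fin n) K))
    (hN : ∀ j : ℤ, ∀ y ∈ N, freeProj K n shift j y ∈ N) :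
    ∃ (s : ℕ) (shift' : Fin s → ℕ) (u : Fin s → Fin r → MvPolynomial (Fin n) K),
      (∀ l, freeProj K n shift (shift' l) (u l) = u l) ∧
      Submodule.span (MvPolynomial (Fin n) K) (Set.range u) = N ∧
      ∀ c : Fin s → MvPolynomial (Fin n) K, ∑ l, c l • u l = 0 →
        ∀ l, constantCoeff (c l) = 0 := by
  classical
  let IsGen : ℕ → Prop := fun s => ∃ (shift' : Fin s → ℕ)
    (u : Fin s → Fin r → MvPolynomial (Fin n) K),
      (∀ l, freeProj K n shift (shift' l) (u l) = u l) ∧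
      Submodule.span (MvPolynomial (Fin n) K) (Set.range u) = N
  have hex : ∃ s, IsGen s := by
    let H : Set (Fin r → MvPolynomial (Fin n) K) :=
      {y | y ∈ N ∧ ∃ d : ℕ, freeProj K n shift d y = y}
    have hH : Submodule.span (MvPolynomial (Fin n) K) H = N := by
      refine le_antisymm (Submodule.span_le.2 fun y hy => hy.1) fun y hy => ?_
      obtain ⟨B, hB⟩ := exists_sum_freeProj_eq shift y
      rw [← hB]
      exact Submodule.sum_mem _ fun i _ => Submodule.subset_span
        ⟨hN i y hy, i, (isGradingProj_freeProj shift).idem i y⟩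
    obtain ⟨t, htH, ht⟩ := (Submodule.fg_span_iff_fg_span_finset_subset H).1
      (hH ▸ IsNoetherian.noetherian N)
    choose δ hδ using fun y : t => (htH y.2).2
    refine ⟨t.card, fun l => δ (t.equivFin.symm l), fun l => t.equivFin.symm l,
      fun l => hδ _, ?_⟩
    rw [← hH, ht]
    congr 1
    ext y
    constructor
    · rintro ⟨l, rfl⟩
      exact (t.equivFin.symm l).2
    · intro hy
      exact ⟨t.equivFin ⟨y, hy⟩, by simp⟩
  -- A homogeneous generating family of least size: a relation with a nonzero constant coefficient
  -- would make one generator redundant.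
  obtain ⟨s, ⟨shift', u, hu, hspan⟩, hmin⟩ : ∃ s, IsGen s ∧ ∀ m < s, ¬ IsGen m :=
    ⟨Nat.find hex, Nat.find_spec hex, fun m => Nat.find_min hex⟩
  refine ⟨s, shift', u, hu, hspan, fun c hc l₀ => ?_⟩
  by_contra hl₀
  cases s with
  | zero => exact l₀.elim0
  | succ s =>
    refine hmin s s.lt_succ_self ⟨fun l => shift' (l₀.succAbove l), fun l => u (l₀.succAbove l),
      fun l => hu _, le_antisymm ?_ ?_⟩
    · rw [← hspan]
      exact Submodule.span_mono (Set.range_comp_subset_range l₀.succAbove u)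
    · rw [← hspan, Submodule.span_le]
      rintro _ ⟨l, rfl⟩
      rcases Fin.eq_self_or_eq_succAbove l₀ l with rfl | ⟨l, rfl⟩
      -- In the degree of `u l` the relation has the nonzero scalar `constantCoeff (c l)` as
      -- coefficient of `u l`, so it can be solved for `u l`.
      · have h := congrArg (freeProj K n shift (shift' l)) hc
        rw [map_sum, map_zero, Fin.sum_univ_succAbove _ l] at h
        simp only [freeProj_smul_of_eq (hu _), sub_self, gradedProj_zero_eq_C] at h
        have h' : u l = (C (constantCoeff (c l))⁻¹ : MvPolynomial (Fin n) K) •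
            (C (constantCoeff (c l)) : MvPolynomial (Fin n) K) • u l := by
          rw [smul_smul, ← C_mul, inv_mul_cancel₀ hl₀, C_1, one_smul]
        rw [h', eq_neg_of_add_eq_zero_left h]
        exact Submodule.smul_mem _ _ (Submodule.neg_mem _ (Submodule.sum_mem _ fun i _ =>
          Submodule.smul_mem _ _ (Submodule.subset_span ⟨i, rfl⟩)))
      · exact Submodule.subset_span ⟨l, rfl⟩

/-- A graded submodule of a graded free module of finite rank. -/
structure GradedSubmoduleOfFree (K : Type*) [Field K] (n : ℕ) where
  rank : ℕ
  shift : Fin rank → ℕ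
  carrier : Submodule (MvPolynomial (Fin n) K) (Fin rank → MvPolynomial (Fin n) K)
  freeProj_mem : ∀ j : ℤ, ∀ y ∈ carrier, freeProj K n shift j y ∈ carrier

namespace GradedSubmoduleOfFree

variable (S : GradedSubmoduleOfFree K n)

noncomputable def nextRank : ℕ :=
  (exists_minimal_homogeneous_generators S.shift S.carrier S.freeProj_mem).choose

noncomputable def nextShift : Fin S.nextRank → ℕ :=
  (exists_minimal_homogeneous_generators S.shift S.carrier S.freeProj_mem).choose_spec.choose

noncomputable def minimalGenerators : Fin S.nextRank → Fin S.rank → MvPolynomial (Fin n) K :=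
  (exists_minimal_homogeneous_generators S.shift S.carrier
    S.freeProj_mem).choose_spec.choose_spec.choose

theorem minimalGenerators_spec :
    (∀ l, freeProj K n S.shift (S.nextShift l) (S.minimalGenerators l) = S.minimalGenerators l) ∧
      Submodule.span (MvPolynomial (Fin n) K) (Set.range S.minimalGenerators) = S.carrier ∧
      ∀ c : Fin S.nextRank → MvPolynomial (Fin n) K, ∑ l, c l • S.minimalGenerators l = 0 →
        ∀ l, constantCoeff (c l) = 0 :=
  (exists_minimal_homogeneous_generators S.shift S.carrier
    S.freeProj_mem).choose_spec.choose_spec.choose_spec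

/-- The matrix whose columns are the minimal generators. -/
noncomputable def matrix : Matrix (Fin S.rank) (Fin S.nextRank) (MvPolynomial (Fin n) K) :=
  Matrix.of fun k l => S.minimalGenerators l k

theorem matrix_mulVec (f : Fin S.nextRank → MvPolynomial (Fin n) K) :
    S.matrix.mulVec f = ∑ l, f l • S.minimalGenerators l := by
  ext1 k
  rw [Finset.sum_apply]
  change ∑ l, S.minimalGenerators l k * f l = ∑ l, f l * S.minimalGenerators l k
  exact Finset.sum_congr rfl fun l _ => mul_comm (S.minimalGenerators l k) (f l)

theorem matrix_homogeneous (k : Fin S.rank) (l : Fin S.nextRank) (h : S.matrix k l ≠ 0) :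
    ∃ e : ℕ, S.shift k + e = S.nextShift l ∧ (S.matrix k l).IsHomogeneous e :=
  isHomogeneous_of_freeProj_eq (S.minimalGenerators_spec.1 l) k h

theorem mem_carrier_iff (f : Fin S.rank → MvPolynomial (Fin n) K) :
    f ∈ S.carrier ↔ ∃ g, f = S.matrix.mulVec g := by
  rw [← S.minimalGenerators_spec.2.1, Submodule.mem_span_range_iff_exists_fun]
  simp only [matrix_mulVec, eq_comm]

/-- The module of relations between the minimal generators. -/
noncomputable def next : GradedSubmoduleOfFree K n where
  rank := S.nextRank
  shift := S.nextShift
  carrier := LinearMap.ker S.matrix.mulVecLin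
  freeProj_mem j y hy := by
    rw [LinearMap.mem_ker, Matrix.mulVecLin_apply] at hy ⊢
    rw [mulVec_freeProj S.matrix_homogeneous, hy, map_zero]

theorem constantCoeff_of_mem_next {f : Fin S.nextRank → MvPolynomial (Fin n) K}
    (hf : f ∈ S.next.carrier) (l) : constantCoeff (f l) = 0 :=
  S.minimalGenerators_spec.2.2 f (by rw [← matrix_mulVec]; exact hf) l

theorem minimalGenerators_mem (l) : S.minimalGenerators l ∈ S.carrier := by
  rw [← S.minimalGenerators_spec.2.1]
  exact Submodule.subset_span ⟨l, rfl⟩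

end GradedSubmoduleOfFree

variable {A : Type*} [CommRing A] [Algebra K A] {𝒜 : ℕ → Submodule K A} [GradedAlgebra 𝒜]
  {x : Fin n → A}

/-- The ideal of the presentation `X i ↦ x i`, as a graded submodule of `R¹`. -/
noncomputable def presentationIdeal (hx : ∀ i, x i ∈ 𝒜 1) : GradedSubmoduleOfFree K n where
  rank := 1
  shift := 0
  carrier :=
    { carrier := {f | aeval x (f 0) = 0}
      add_mem' := fun {f g} hf hg => by
        change aeval x (f 0 + g 0) = 0
        rw [map_add, show aeval x (f 0) = 0 from hf, show aeval x (g 0) = 0 from hg, add_zero]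
      zero_mem' := map_zero (aeval x)
      smul_mem' := fun c f hf => by
        change aeval x (c * f 0) = 0
        rw [map_mul, show aeval x (f 0) = 0 from hf, mul_zero] }
  freeProj_mem j y hy := by
    change aeval x (gradedProj (homogeneousSubmodule (Fin n) K) _ (y 0)) = 0
    rw [aeval_gradedProj hx, show aeval x (y 0) = 0 from hy, map_zero]

theorem nonempty_minimalGradedFreeResolution [Nontrivial A] (hx : IsLinearGenerators 𝒜 x) :
    Nonempty (MinimalGradedFreeResolution 𝒜 x) := by
  let S : ℕ → GradedSubmoduleOfFree K n := fun i =>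
    Nat.rec (presentationIdeal hx.mem) (fun _ T => T.next) i
  have hS : ∀ f : Fin 1 → MvPolynomial (Fin n) K,
      ∑ k : Fin 1, aeval x (f k) * 1 = 0 ↔ f ∈ (S 0).carrier := fun f => by
    rw [Fin.sum_univ_one, mul_one]
    rfl
  exact ⟨{
    rank := fun i => (S i).rank
    shift := fun i => (S i).shift
    gen := fun _ => 1
    diff := fun i => (S i).matrix
    gen_mem := fun _ => SetLike.GradedOne.one_mem (A := 𝒜)
    diff_homogeneous := fun i => (S i).matrix_homogeneous
    surjective := fun y => by
      have hy : y ∈ Algebra.adjoin K (Set.range x) := hx.generate ▸ Algebra.mem_top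
      rw [Algebra.adjoin_range_eq_range_aeval] at hy
      obtain ⟨f, hf⟩ := hy
      exact ⟨fun _ => f, (Fin.sum_univ_one _).trans ((mul_one _).trans hf)⟩
    exact_zero := fun f => (hS f).trans ((S 0).mem_carrier_iff f)
    exact_succ := fun i f => (S i).next.mem_carrier_iff f
    minimal := fun i k l => by
      cases i with
      | zero =>
        -- The degree-zero part of a relation between the `x i` is a scalar that vanishes in `A`,
        -- hence is zero because `A` is nontrivial.
        have h : aeval x ((S 0).minimalGenerators l (0 : Fin 1)) = 0 :=
          (S 0).minimalGenerators_mem l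
        have h' := congrArg (gradedProj 𝒜 0) h
        rw [← aeval_gradedProj hx.mem, gradedProj_zero_eq_C, map_zero, aeval_C,
          map_eq_zero_iff _ (FaithfulSMul.algebraMap_injective K A)] at h'
        rw [show k = (0 : Fin 1) from Subsingleton.elim (α := Fin 1) _ _]
        exact h'
      | succ i =>
        exact (S i).constantCoeff_of_mem_next ((S i).next.minimalGenerators_mem l) k }⟩

end ResolutionExistence

/-! ### Homogeneous prime avoidance -/

section HomogeneousPrimeAvoidance

variable {K A : Type*} [CommRing K] [CommRing A] [Algebra K A] {𝒜 : ℕ → Submodule K A}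
  [GradedAlgebra 𝒜]

theorem Ideal.IsHomogeneous.exists_homogeneous_mem_notMem {p q : Ideal A}
    (hq : q.IsHomogeneous 𝒜) (h : ¬ q ≤ p) : ∃ i, ∃ w ∈ 𝒜 i, w ∈ q ∧ w ∉ p := by
  classical
  by_contra! H
  refine h fun a ha => ?_
  rw [← DirectSum.sum_support_decompose 𝒜 a]
  exact Ideal.sum_mem _ fun i _ => H i _ (SetLike.coe_mem _) (hq i ha)

/-- Prime avoidance by a homogeneous element of positive degree, for homogeneous primes. -/
theorem exists_homogeneous_notMem_of_isHomogeneous (S : Finset (Ideal A))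
    (hprime : ∀ p ∈ S, p.IsPrime) (hhom : ∀ p ∈ S, p.IsHomogeneous 𝒜)
    (hS : ∀ p ∈ S, ∃ i, 0 < i ∧ ∃ u ∈ 𝒜 i, u ∉ p) :
    ∃ e, 0 < e ∧ ∃ θ ∈ 𝒜 e, ∀ p ∈ S, θ ∉ p := by
  classical
  induction hn : S.card generalizing S with
  | zero =>
    obtain rfl := Finset.card_eq_zero.1 hn
    exact ⟨1, one_pos, 0, zero_mem _, by simp⟩
  | succ n ih =>
    have hne : S.Nonempty := Finset.card_pos.1 (by omega)
    -- By minimality no other prime of `S` lies inside `p`, so some homogeneous `W` lies in all the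
    -- others but not in `p`; its factor `u` makes the degree positive.
    obtain ⟨p, hp⟩ := S.exists_minimal hne
    have hpS : p ∈ S := hp.1
    have hsub : ∀ q ∈ S.erase p, q ∈ S := fun q hq => Finset.mem_of_mem_erase hq
    obtain ⟨e, he, θ, hθ, hθS⟩ := ih (S.erase p) (fun q hq => hprime q (hsub q hq))
      (fun q hq => hhom q (hsub q hq)) (fun q hq => hS q (hsub q hq))
      (by rw [Finset.card_erase_of_mem hpS, hn, Nat.add_sub_cancel])
    have hpp := hprime p hpS
    by_cases hθp : θ ∈ p
    · have hw : ∀ q : S.erase p, ∃ i, ∃ w ∈ 𝒜 i, w ∈ q.1 ∧ w ∉ p := fun q =>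
        (hhom q.1 (hsub q.1 q.2)).exists_homogeneous_mem_notMem fun hqp =>
          Finset.ne_of_mem_erase q.2 (le_antisymm hqp (hp.2 (hsub q.1 q.2) hqp))
      choose δ w hwδ hwq hwp using hw
      obtain ⟨i, hi, u, hu, hup⟩ := hS p hpS
      have hW : u * ∏ q, w q ∈ 𝒜 (i + ∑ q, δ q) :=
        SetLike.mul_mem_graded hu (SetLike.prod_mem_graded _ _ _ fun q _ => hwδ q)
      set W := u * ∏ q, w q
      set c := i + ∑ q, δ q
      have hc : 0 < c := by omega
      have hWp : W ∉ p := by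
        intro h
        rcases hpp.mem_or_mem h with h | h
        · exact hup h
        · obtain ⟨q, _, hq⟩ := (hpp.prod_mem_iff).1 h
          exact hwp q hq
      -- The exponents equalise the degrees. Modulo `p` only the power of `W` survives, modulo the
      -- other primes only the power of `θ`.
      refine ⟨c * e, Nat.mul_pos hc he, θ ^ c + W ^ e, add_mem ?_ ?_, fun q hq h => ?_⟩
      · simpa using SetLike.pow_mem_graded c hθ
      · simpa [mul_comm c e] using SetLike.pow_mem_graded e hW
      · by_cases hqp : q = p
        · subst hqp
          exact hWp (hpp.mem_of_pow_mem e
            ((Ideal.add_mem_iff_right _ (Ideal.pow_mem_of_mem _ hθp c hc)).1 h))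
        · have hqe := Finset.mem_erase.2 ⟨hqp, hq⟩
          have hWq : W ∈ q := Ideal.mul_mem_left _ _ (Ideal.mem_of_dvd _
            (Finset.dvd_prod_of_mem w (Finset.mem_univ (⟨q, hqe⟩ : S.erase p))) (hwq ⟨q, hqe⟩))
          exact hθS q hqe ((hprime q hq).mem_of_pow_mem c
            ((Ideal.add_mem_iff_left _ (Ideal.pow_mem_of_mem _ hWq e he)).1 h))
    · refine ⟨e, he, θ, hθ, fun q hq => ?_⟩
      by_cases hqp : q = p
      · rwa [hqp]
      · exact hθS q (Finset.mem_erase.2 ⟨hqp, hq⟩)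

/-- Prime avoidance by a homogeneous element of positive degree. -/
theorem exists_homogeneous_notMem {S : Set (Ideal A)} (hfin : S.Finite)
    (hprime : ∀ p ∈ S, p.IsPrime) (hS : ∀ p ∈ S, ∃ i, 0 < i ∧ ∃ u ∈ 𝒜 i, u ∉ p) :
    ∃ e, 0 < e ∧ ∃ θ ∈ 𝒜 e, ∀ p ∈ S, θ ∉ p := by
  classical
  -- A prime and its homogeneous core, again prime, contain the same homogeneous elements.
  obtain ⟨e, he, θ, hθ, h⟩ := exists_homogeneous_notMem_of_isHomogeneous (𝒜 := 𝒜)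
    (hfin.toFinset.image fun p => (p.homogeneousCore 𝒜).toIdeal)
    (by simpa using fun p hp => (hprime p hp).homogeneousCore)
    (by simpa using fun p _ => (p.homogeneousCore 𝒜).isHomogeneous)
    (by
      simp only [Finset.mem_image, Set.Finite.mem_toFinset, forall_exists_index, and_imp,
        forall_apply_eq_imp_iff₂]
      intro p hp
      obtain ⟨i, hi, u, hu, hup⟩ := hS p hp
      exact ⟨i, hi, u, hu, fun h => hup (Ideal.toIdeal_homogeneousCore_le 𝒜 p h)⟩)
  refine ⟨e, he, θ, hθ, fun p hp hθp => h _ (Finset.mem_image_of_mem _ (by simpa using hp)) ?_⟩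
  exact Ideal.mem_homogeneousCore_of_homogeneous_of_mem ⟨e, hθ⟩ hθp

end HomogeneousPrimeAvoidance

/-! ### The irrelevant ideal of a standard graded algebra -/

section StandardGraded

open MvPolynomial

attribute [local instance] MvPolynomial.gradedAlgebra

variable {K A : Type*} [Field K] [CommRing A] [Algebra K A] {𝒜 : ℕ → Submodule K A}
  [GradedAlgebra 𝒜]

theorem mem_irrelevant_iff_gradedProj (a : A) :
    a ∈ (HomogeneousIdeal.irrelevant 𝒜).toIdeal ↔ gradedProj 𝒜 0 a = 0 := by
  have h := gradedProj_natCast 𝒜 0 a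
  rw [Nat.cast_zero] at h
  rw [h]
  rfl

theorem mem_irrelevant_of_mem_pos {e : ℕ} (he : 0 < e) {a : A} (ha : a ∈ 𝒜 e) :
    a ∈ (HomogeneousIdeal.irrelevant 𝒜).toIdeal :=
  HomogeneousIdeal.mem_irrelevant_of_mem 𝒜 he ha

theorem irrelevant_eq_span_range {n : ℕ} {x : Fin n → A} (hx : IsLinearGenerators 𝒜 x) :
    (HomogeneousIdeal.irrelevant 𝒜).toIdeal = Ideal.span (Set.range x) := by
  refine le_antisymm (fun a ha => ?_) (Ideal.span_le.2 ?_)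
  · have hy : a ∈ Algebra.adjoin K (Set.range x) := hx.generate ▸ Algebra.mem_top
    rw [Algebra.adjoin_range_eq_range_aeval] at hy
    obtain ⟨f, rfl⟩ := hy
    change aeval x f ∈ _ at ha
    change aeval x f ∈ _
    rw [mem_irrelevant_iff_gradedProj, ← aeval_gradedProj hx.mem, gradedProj_zero_eq_C] at ha
    have h : f - C (constantCoeff f) ∈ Ideal.span (Set.range X) :=
      (mem_span_range_X_iff _).2 (by simp)
    have h' := Ideal.mem_map_of_mem (aeval x) h
    rw [map_sub, ha, sub_zero, Ideal.map_span, ← Set.range_comp] at h'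
    convert h'
    ext i
    simp
  · rintro _ ⟨i, rfl⟩
    exact mem_irrelevant_of_mem_pos one_pos (hx.mem i)

theorem exists_algebraMap_eq_gradedProj_zero (hstd : IsStandardGraded 𝒜) (a : A) :
    ∃ c : K, algebraMap K A c = gradedProj 𝒜 0 a := by
  have h := gradedProj_natCast_mem (𝒜 := 𝒜) 0 a
  rw [hstd.degree_zero] at h
  exact h

/-- The degree-zero component of an element of `I` is a scalar lying in `I`; if nonzero it would be
a unit. -/
theorem le_irrelevant_of_isHomogeneous (hstd : IsStandardGraded 𝒜) {I : Ideal A}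
    (hI : I.IsHomogeneous 𝒜) (hI' : I ≠ ⊤) : I ≤ (HomogeneousIdeal.irrelevant 𝒜).toIdeal := by
  intro a ha
  rw [mem_irrelevant_iff_gradedProj]
  obtain ⟨c, hc⟩ := exists_algebraMap_eq_gradedProj_zero hstd a
  have h : gradedProj 𝒜 0 a ∈ I := by
    have := hI 0 ha
    rwa [← gradedProj_natCast] at this
  by_cases hc0 : c = 0
  · rw [← hc, hc0, map_zero]
  · exact absurd (I.eq_top_of_isUnit_mem h (hc ▸ (IsUnit.mk0 c hc0).map _)) hI'

theorem irrelevant_ne_top [Nontrivial A] : (HomogeneousIdeal.irrelevant 𝒜).toIdeal ≠ ⊤ := by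
  rw [Ne, Ideal.eq_top_iff_one, mem_irrelevant_iff_gradedProj]
  have : gradedProj 𝒜 ((0 : ℕ) : ℤ) (1 : A) = 1 :=
    gradedProj_of_mem_same SetLike.GradedOne.one_mem
  rw [Nat.cast_zero] at this
  rw [this]
  exact one_ne_zero

theorem irrelevant_isMaximal [Nontrivial A] (hstd : IsStandardGraded 𝒜) :
    (HomogeneousIdeal.irrelevant 𝒜).toIdeal.IsMaximal := by
  rw [Ideal.isMaximal_iff]
  refine ⟨fun h => irrelevant_ne_top ((Ideal.eq_top_iff_one _).2 h), fun J a hJ ha haJ => ?_⟩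
  obtain ⟨c, hc⟩ := exists_algebraMap_eq_gradedProj_zero hstd a
  have hc0 : c ≠ 0 := by
    rintro rfl
    rw [mem_irrelevant_iff_gradedProj, ← hc, map_zero] at ha
    exact ha rfl
  have h : a - gradedProj 𝒜 0 a ∈ J := hJ (by
    rw [mem_irrelevant_iff_gradedProj, map_sub, gradedProj_idem, sub_self])
  have h' : algebraMap K A c ∈ J := by
    rw [hc]
    rw [← sub_sub_cancel a (gradedProj 𝒜 0 a)]
    exact J.sub_mem haJ h
  exact (Ideal.eq_top_iff_one J).1 (J.eq_top_of_isUnit_mem h' ((IsUnit.mk0 c hc0).map _))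

/-- Each of finitely many algebra generators is a polynomial in finitely many elements of degree
one; these are collected. -/
theorem exists_isLinearGenerators [Algebra.FiniteType K A] (hstd : IsStandardGraded 𝒜) :
    ∃ (n : ℕ) (x : Fin n → A), IsLinearGenerators 𝒜 x := by
  classical
  obtain ⟨s, hs⟩ := ‹Algebra.FiniteType K A›.out
  have h : ∀ a : A, ∃ t : Finset A, (t : Set A) ⊆ 𝒜 1 ∧ a ∈ Algebra.adjoin K (t : Set A) := by
    intro a
    have ha : a ∈ Algebra.adjoin K (𝒜 1 : Set A) := hstd.generated ▸ Algebra.mem_top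
    induction ha using Algebra.adjoin_induction with
    | mem a ha => exact ⟨{a}, by simpa using ha, Algebra.subset_adjoin (by simp)⟩
    | algebraMap c => exact ⟨∅, by simp, Subalgebra.algebraMap_mem _ c⟩
    | add a b _ _ ha hb =>
      obtain ⟨t, ht, ha⟩ := ha
      obtain ⟨u, hu, hb⟩ := hb
      refine ⟨t ∪ u, by simp [ht, hu], add_mem ?_ ?_⟩
      · exact Algebra.adjoin_mono (by simp) ha
      · exact Algebra.adjoin_mono (by simp) hb
    | mul a b _ _ ha hb =>
      obtain ⟨t, ht, ha⟩ := ha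
      obtain ⟨u, hu, hb⟩ := hb
      refine ⟨t ∪ u, by simp [ht, hu], mul_mem ?_ ?_⟩
      · exact Algebra.adjoin_mono (by simp) ha
      · exact Algebra.adjoin_mono (by simp) hb
  choose t ht hat using h
  let T : Finset A := s.biUnion t
  refine ⟨T.card, fun i => T.equivFin.symm i, fun i => ?_, ?_⟩
  · obtain ⟨a, _, ha⟩ := Finset.mem_biUnion.1 (T.equivFin.symm i).2
    exact ht a ha
  · rw [eq_top_iff, ← hs, Algebra.adjoin_le_iff]
    intro a ha
    refine Algebra.adjoin_mono (fun b hb => ?_) (hat a)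
    exact ⟨T.equivFin ⟨b, Finset.mem_biUnion.2 ⟨a, ha, hb⟩⟩, by simp⟩

/-- Turns a containment of a power of the irrelevant ideal in `J` into the vanishing of `A/J` in
large degrees. -/
theorem mem_irrelevant_pow {n : ℕ} {x : Fin n → A} (hx : IsLinearGenerators 𝒜 x) {i : ℕ} {a : A}
    (ha : a ∈ 𝒜 i) : a ∈ (HomogeneousIdeal.irrelevant 𝒜).toIdeal ^ i := by
  have hy : a ∈ Algebra.adjoin K (Set.range x) := hx.generate ▸ Algebra.mem_top
  rw [Algebra.adjoin_range_eq_range_aeval] at hy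
  obtain ⟨f, rfl⟩ := hy
  change aeval x f ∈ _ at ha
  change aeval x f ∈ _
  rw [← gradedProj_of_mem_same ha, ← aeval_gradedProj hx.mem]
  have hf := gradedProj_natCast_mem (𝒜 := homogeneousSubmodule (Fin n) K) i f
  set g := gradedProj (homogeneousSubmodule (Fin n) K) i f
  rw [g.as_sum, map_sum]
  refine Ideal.sum_mem _ fun m hm => ?_
  have hdeg := (mem_homogeneousSubmodule i g).1 hf (mem_support_iff.1 hm)
  rw [aeval_monomial]
  refine Ideal.mul_mem_left _ _ ?_
  have hi : i = ∑ k ∈ m.support, m k := by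
    rw [← hdeg, Finsupp.weight_apply]
    simp [Finsupp.sum]
  rw [hi, ← Finset.prod_pow_eq_pow_sum]
  exact Ideal.prod_mem_prod fun k _ =>
    Ideal.pow_mem_pow (mem_irrelevant_of_mem_pos one_pos (hx.mem k)) _

theorem finiteDimensional_graded {n : ℕ} {x : Fin n → A} (hx : IsLinearGenerators 𝒜 x) (i : ℕ) :
    FiniteDimensional K (𝒜 i) := by
  have hle : 𝒜 i ≤ Submodule.map (aeval x).toLinearMap (homogeneousSubmodule (Fin n) K i) := by
    intro a ha
    have hy : a ∈ Algebra.adjoin K (Set.range x) := hx.generate ▸ Algebra.mem_top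
    rw [Algebra.adjoin_range_eq_range_aeval] at hy
    obtain ⟨f, rfl⟩ := hy
    change aeval x f ∈ _ at ha
    refine ⟨_, gradedProj_natCast_mem i f, ?_⟩
    exact (aeval_gradedProj hx.mem i f).trans (gradedProj_of_mem_same ha)
  have : FiniteDimensional K (homogeneousSubmodule (Fin n) K i) :=
    Module.Finite.iff_fg.2 (homogeneousSubmodule_fg (Fin n) K i)
  exact Submodule.finiteDimensional_of_le hle

end StandardGraded

/-! ### From depth to homogeneous regular sequences -/

section HomogeneousRegularSequence

open KoszulChain
open scoped Pointwise

/-- Vanishing of `H_{p+1}(M/rM)` forces `H_p(M) = 0`, so each regular element in `(x)` lowers the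
vanishing range by one. The elements need not be homogeneous. -/
theorem koszulVanishes_of_isWeaklyRegular {R : Type*} [CommRing R] {x : ℕ → R} {n : ℕ}
    (rs : List R) : ∀ (M : Type*) [AddCommGroup M] [Module R M],
      (∀ r ∈ rs, r ∈ Ideal.span (x '' Set.Iio n)) → RingTheory.Sequence.IsWeaklyRegular M rs →
      ∀ p : ℤ, (n : ℤ) - rs.length < p → KoszulVanishes x n (fun _ => AddMonoidHom.id M) p 0 := by
  induction rs with
  | nil =>
    intro M _ _ _ _ p hp
    exact koszulVanishes_of_gt (by simpa using hp)
  | cons r rs ih =>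
    intro M _ _ hrs hreg p hp
    rw [RingTheory.Sequence.isWeaklyRegular_cons_iff] at hreg
    have h := ih (QuotSMulTop r M) (fun s hs => hrs s (List.mem_cons_of_mem r hs)) hreg.2 (p + 1)
      (by rw [List.length_cons] at hp; push_cast at hp; omega)
    rw [koszulVanishes_quotient_iff (e := 0) (g := (r • (⊤ : Submodule R M)).mkQ)
      (π := fun _ => AddMonoidHom.id M) isGradingProj_id
      (hrs r List.mem_cons_self) hreg.1 (fun _ _ => rfl) ?_ (Submodule.mkQ_surjective _)
      fun _ _ => rfl, add_sub_cancel_right, sub_zero] at h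
    · exact h.2
    · intro y
      rw [Submodule.mkQ_apply, Submodule.Quotient.mk_eq_zero,
        Submodule.mem_smul_pointwise_iff_exists]
      simp

variable {K A : Type*} [Field K] [CommRing A] [Algebra K A] {𝒜 : ℕ → Submodule K A}

/-- The list `l` of pairs `(θ, e)` consists of homogeneous elements `θ` of positive degree `e`
forming a weakly regular sequence on `A ⧸ I`, and `J` is the sum of `I` and the ideal generated by
these elements. -/
inductive IsHomogeneousRegular (𝒜 : ℕ → Submodule K A) : Ideal A → List (A × ℕ) → Ideal A → Prop
  | nil (I : Ideal A) : IsHomogeneousRegular 𝒜 I [] I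
  | cons {I J : Ideal A} {θ : A} {e : ℕ} {l : List (A × ℕ)} (mem : θ ∈ 𝒜 e) (pos : 0 < e)
      (reg : ∀ a, θ * a ∈ I → a ∈ I) (tail : IsHomogeneousRegular 𝒜 (I ⊔ Ideal.span {θ}) l J) :
      IsHomogeneousRegular 𝒜 I ((θ, e) :: l) J

/-- An element regular modulo `I` avoids the minimal primes of `I`, so each step of the sequence
gives a strict inclusion of primes. -/
theorem IsHomogeneousRegular.height_le {I J : Ideal A} {l : List (A × ℕ)}
    (h : IsHomogeneousRegular 𝒜 I l J) (p : Ideal A) [hp : p.IsPrime] (hJp : J ≤ p) :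
    ∃ q ∈ I.minimalPrimes, q ≤ p ∧ q.height + l.length ≤ p.height := by
  induction h with
  | nil I =>
    obtain ⟨q, hq, hqp⟩ := Ideal.exists_minimalPrimes_le hJp
    exact ⟨q, hq, hqp, by simpa using Ideal.height_mono hqp⟩
  | @cons I J θ e l mem pos reg tail ih =>
    obtain ⟨q, hq, hqp, hle⟩ := ih hJp
    have hqprime : q.IsPrime := hq.1.1
    obtain ⟨q', hq', hqq'⟩ := Ideal.exists_minimalPrimes_le (le_sup_left.trans hq.1.2)
    have hq'prime : q'.IsPrime := hq'.1.1
    have hθq : θ ∈ q := hq.1.2 (Ideal.mem_sup_right (Ideal.mem_span_singleton_self θ))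
    have hθq' : θ ∉ q' := by
      intro hmem
      obtain ⟨y, hy, hxy⟩ := Ideal.exists_mul_mem_of_mem_minimalPrimes hq' hmem
      exact hy (reg y hxy)
    have hlt : q' < q := lt_of_le_of_ne hqq' (by rintro rfl; exact hθq' hθq)
    refine ⟨q', hq', hqq'.trans hqp, le_trans ?_ hle⟩
    rw [List.length_cons, Nat.cast_succ, add_comm (l.length : ℕ∞), ← add_assoc]
    gcongr
    exact Ideal.height_add_one_le_of_lt_of_isPrime hlt

variable [GradedAlgebra 𝒜]

theorem Ideal.IsHomogeneous.gradedProj_mem {I : Ideal A} (hI : I.IsHomogeneous 𝒜) (j : ℤ) {a : A}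
    (ha : a ∈ I) : gradedProj 𝒜 j a ∈ I := by
  rcases lt_or_ge j 0 with h | h
  · rw [gradedProj_of_neg 𝒜 h]
    exact I.zero_mem
  · lift j to ℕ using h
    rw [gradedProj_natCast]
    exact hI j ha

/-- The projections onto the homogeneous parts of `A ⧸ I`. -/
def quotientProj {I : Ideal A} (hI : I.IsHomogeneous 𝒜) (j : ℤ) : A ⧸ I →+ A ⧸ I :=
  QuotientAddGroup.lift I.toAddSubgroup
    ((Ideal.Quotient.mk I).toAddMonoidHom.comp (gradedProj 𝒜 j).toAddMonoidHom)
    fun _ ha => Ideal.Quotient.eq_zero_iff_mem.2 (hI.gradedProj_mem j ha)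

theorem quotientProj_mk {I : Ideal A} (hI : I.IsHomogeneous 𝒜) (j : ℤ) (a : A) :
    quotientProj hI j (Ideal.Quotient.mk I a) = Ideal.Quotient.mk I (gradedProj 𝒜 j a) := rfl

theorem quotientProj_smul {I : Ideal A} (hI : I.IsHomogeneous 𝒜) {e : ℕ} {θ : A} (hθ : θ ∈ 𝒜 e)
    (j : ℤ) (y : A ⧸ I) : quotientProj hI j (θ • y) = θ • quotientProj hI (j - e) y := by
  obtain ⟨a, rfl⟩ := Ideal.Quotient.mk_surjective y
  change quotientProj hI j (Ideal.Quotient.mk I (θ * a)) = _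
  rw [quotientProj_mk, quotientProj_mk, gradedProj_mul hθ]
  rfl

theorem isGradingProj_quotientProj {n : ℕ} {x : Fin n → A} (hx : ∀ i, x i ∈ 𝒜 1) {I : Ideal A}
    (hI : I.IsHomogeneous 𝒜) : IsGradingProj (extendByZero x) n (quotientProj hI) where
  idem j y := by
    obtain ⟨a, rfl⟩ := Ideal.Quotient.mk_surjective y
    rw [quotientProj_mk, quotientProj_mk, gradedProj_idem]
  smul i hi j y := by
    rw [extendByZero_val x ⟨i, hi⟩]
    exact quotientProj_smul hI (hx ⟨i, hi⟩) j y

theorem isHomogeneous_sup_span_singleton {I : Ideal A} (hI : I.IsHomogeneous 𝒜) {e : ℕ} {θ : A}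
    (hθ : θ ∈ 𝒜 e) : (I ⊔ Ideal.span {θ}).IsHomogeneous 𝒜 :=
  hI.sup (Ideal.homogeneous_span 𝒜 _ (by rintro _ rfl; exact ⟨e, hθ⟩))

theorem isSMulRegular_quotient {I : Ideal A} {θ : A} (hreg : ∀ a, θ * a ∈ I → a ∈ I) :
    IsSMulRegular (A ⧸ I) θ := by
  rw [isSMulRegular_iff_right_eq_zero_of_smul]
  intro y hy
  obtain ⟨a, rfl⟩ := Ideal.Quotient.mk_surjective y
  exact Ideal.Quotient.eq_zero_iff_mem.2 (hreg a (Ideal.Quotient.eq_zero_iff_mem.1 hy))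

theorem exact_smul_factor (I : Ideal A) (θ : A) :
    Function.Exact (fun y : A ⧸ I => θ • y)
      (Submodule.factor (le_sup_left : I ≤ I ⊔ Ideal.span {θ})) := by
  intro y
  obtain ⟨a, rfl⟩ := Ideal.Quotient.mk_surjective y
  change Ideal.Quotient.mk (I ⊔ Ideal.span {θ}) a = 0 ↔ _
  rw [Ideal.Quotient.eq_zero_iff_mem, Submodule.mem_sup]
  constructor
  · rintro ⟨i, hi, z, hz, rfl⟩
    obtain ⟨b, rfl⟩ := Ideal.mem_span_singleton'.1 hz
    refine ⟨Ideal.Quotient.mk I b, ?_⟩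
    change Ideal.Quotient.mk I (θ * b) = _
    rw [Ideal.Quotient.eq, mul_comm b θ, sub_add_cancel_right]
    exact I.neg_mem hi
  · rintro ⟨z, hz⟩
    obtain ⟨b, rfl⟩ := Ideal.Quotient.mk_surjective z
    change Ideal.Quotient.mk I (θ * b) = _ at hz
    exact ⟨a - θ * b, Ideal.Quotient.eq.1 hz.symm, θ * b,
      Ideal.mul_mem_right _ _ (Ideal.mem_span_singleton_self θ), sub_add_cancel _ _⟩

theorem factor_quotientProj {I J : Ideal A} (hI : I.IsHomogeneous 𝒜) (hJ : J.IsHomogeneous 𝒜)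
    (h : I ≤ J) (j : ℤ) (y : A ⧸ I) :
    Submodule.factor h (quotientProj hI j y) = quotientProj hJ j (Submodule.factor h y) := by
  obtain ⟨a, rfl⟩ := Ideal.Quotient.mk_surjective y
  rfl

theorem factor_surjective {I J : Ideal A} (h : I ≤ J) :
    Function.Surjective (Submodule.factor h) := by
  intro y
  obtain ⟨a, rfl⟩ := Ideal.Quotient.mk_surjective y
  exact ⟨Ideal.Quotient.mk I a, rfl⟩

variable {n : ℕ} {x : Fin n → A}

theorem mem_span_extendByZero (hx : IsLinearGenerators 𝒜 x) {a : A}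
    (ha : a ∈ (HomogeneousIdeal.irrelevant 𝒜).toIdeal) :
    a ∈ Ideal.span (extendByZero x '' Set.Iio n) := by
  rwa [extendByZero_image_Iio_self, ← irrelevant_eq_span_range hx]

theorem koszulVanishes_sup_span_iff (hx : IsLinearGenerators 𝒜 x) {I : Ideal A}
    (hI : I.IsHomogeneous 𝒜) {e : ℕ} (he : 0 < e) {θ : A} (hθ : θ ∈ 𝒜 e)
    (hreg : ∀ a, θ * a ∈ I → a ∈ I) {p j : ℤ} :
    KoszulVanishes (extendByZero x) n (quotientProj (isHomogeneous_sup_span_singleton hI hθ)) p j ↔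
      KoszulVanishes (extendByZero x) n (quotientProj hI) p j ∧
        KoszulVanishes (extendByZero x) n (quotientProj hI) (p - 1) (j - e) :=
  koszulVanishes_quotient_iff (isGradingProj_quotientProj hx.mem hI)
    (mem_span_extendByZero hx (mem_irrelevant_of_mem_pos he hθ))
    (isSMulRegular_quotient hreg) (quotientProj_smul hI hθ) (exact_smul_factor I θ)
    (factor_surjective _) (factor_quotientProj hI (isHomogeneous_sup_span_singleton hI hθ) _)

theorem IsHomogeneousRegular.isHomogeneous {I J : Ideal A} {l : List (A × ℕ)}
    (h : IsHomogeneousRegular 𝒜 I l J) (hI : I.IsHomogeneous 𝒜) : J.IsHomogeneous 𝒜 := by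
  induction h with
  | nil => exact hI
  | cons mem _ _ _ ih => exact ih (isHomogeneous_sup_span_singleton hI mem)

theorem IsHomogeneousRegular.le_irrelevant {I J : Ideal A} {l : List (A × ℕ)}
    (h : IsHomogeneousRegular 𝒜 I l J) (hI : I ≤ (HomogeneousIdeal.irrelevant 𝒜).toIdeal) :
    J ≤ (HomogeneousIdeal.irrelevant 𝒜).toIdeal := by
  induction h with
  | nil => exact hI
  | cons mem pos _ _ ih =>
    exact ih (sup_le hI ((Ideal.span_singleton_le_iff_mem _).2 (mem_irrelevant_of_mem_pos pos mem)))

/-- Positive depth yields a homogeneous regular element. -/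
theorem exists_homogeneous_regular_of_koszulVanishes [IsNoetherianRing A]
    (hx : IsLinearGenerators 𝒜 x) {I : Ideal A}
    (h : KoszulVanishes (extendByZero x) n (fun _ => AddMonoidHom.id (A ⧸ I)) n 0) :
    ∃ e, 0 < e ∧ ∃ θ ∈ 𝒜 e, ∀ a, θ * a ∈ I → a ∈ I := by
  rcases subsingleton_or_nontrivial A with hA | hA
  · exact ⟨1, one_pos, 0, zero_mem _, fun a _ => by
      rw [Subsingleton.elim a 0]; exact I.zero_mem⟩
  have hsocle : ∀ y : A ⧸ I, (∀ i, x i • y = 0) → y = 0 := fun y hy =>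
    KoszulVanishes.eq_zero_of_smul_eq_zero (j := 0) (π := fun _ => AddMonoidHom.id (A ⧸ I))
      isGradingProj_id h.of_ungraded rfl fun i hi => by
        rw [extendByZero_val x ⟨i, hi⟩]; exact hy _
  -- An associated prime containing all elements of positive degree would annihilate a nonzero
  -- element killed by every `x i`, against `hsocle`. A homogeneous element avoiding the associated
  -- primes is regular.
  obtain ⟨e, he, θ, hθ, hθS⟩ := exists_homogeneous_notMem (𝒜 := 𝒜)
    (associatedPrimes.finite A (A ⧸ I)) (fun p hp => hp.1) (by
      intro p hp
      by_contra! H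
      obtain ⟨hpp, y, hy⟩ := isAssociatedPrime_iff.1 hp
      refine hpp.ne_top ?_
      have hy0 : y = 0 := hsocle y fun i => by
        have := H 1 one_pos (x i) (hx.mem i)
        rw [hy] at this
        simpa using this
      rw [hy, hy0]
      simp)
  refine ⟨e, he, θ, hθ, fun a ha => ?_⟩
  by_contra ha'
  have : θ ∈ ⋃ p ∈ associatedPrimes A (A ⧸ I), (p : Set A) := by
    rw [biUnion_associatedPrimes_eq_zero_divisors]
    exact ⟨Ideal.Quotient.mk I a, fun h0 => ha' (Ideal.Quotient.eq_zero_iff_mem.1 h0),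
      Ideal.Quotient.eq_zero_iff_mem.2 ha⟩
  obtain ⟨p, hp, hθp⟩ := Set.mem_iUnion₂.1 this
  exact hθS p hp hθp

/-- Converse to `koszulVanishes_of_isWeaklyRegular`: together they replace any regular sequence in
the irrelevant ideal by a homogeneous one of the same length. -/
theorem exists_isHomogeneousRegular [IsNoetherianRing A]
    (hx : IsLinearGenerators 𝒜 x) (k : ℕ) :
    ∀ I : Ideal A, (∀ p : ℤ, (n : ℤ) - k < p →
        KoszulVanishes (extendByZero x) n (fun _ => AddMonoidHom.id (A ⧸ I)) p 0) →
      ∃ l J, IsHomogeneousRegular 𝒜 I l J ∧ l.length = k := by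
  induction k with
  | zero => exact fun I _ => ⟨[], I, .nil I, rfl⟩
  | succ k ih =>
    intro I h
    obtain ⟨e, he, θ, hθ, hreg⟩ :=
      exists_homogeneous_regular_of_koszulVanishes hx (h n (by push_cast; omega))
    have hθ' := mem_irrelevant_of_mem_pos he hθ
    obtain ⟨l, J, hl, hlk⟩ := ih (I ⊔ Ideal.span {θ}) fun p hp => by
        rw [koszulVanishes_quotient_iff (e := 0)
          (g := Submodule.factor (le_sup_left : I ≤ I ⊔ Ideal.span {θ}))
          (π := fun _ => AddMonoidHom.id (A ⧸ I)) isGradingProj_id (mem_span_extendByZero hx hθ')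
          (isSMulRegular_quotient hreg) (fun _ _ => rfl) (exact_smul_factor I θ)
          (factor_surjective _) (fun _ _ => rfl), sub_zero]
        push_cast at h
        exact ⟨h p (by omega), h (p - 1) (by omega)⟩
    exact ⟨(θ, e) :: l, J, .cons hθ he hreg hl, by rw [List.length_cons, hlk]⟩

end HomogeneousRegularSequence

/-! ### Regularity computed modulo a regular sequence -/

section RegularityOfCohenMacaulay

variable {K A : Type*} [Field K] [CommRing A] [Algebra K A] {𝒜 : ℕ → Submodule K A}
  [GradedAlgebra 𝒜]

theorem koszulVanishes_quotient_bot_iff {n : ℕ} {x : Fin n → A} {p j : ℤ}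
    (hI : (⊥ : Ideal A).IsHomogeneous 𝒜) :
    KoszulVanishes (extendByZero x) n (quotientProj hI) p j ↔
      KoszulVanishes (extendByZero x) n (gradedAddProj 𝒜) p j := by
  let e : A ≃+ A ⧸ (⊥ : Ideal A) := (RingEquiv.quotientBot A).symm.toAddEquiv
  refine ⟨fun h => h.of_addEquiv e.symm (fun i _ y => ?_) (fun j y => ?_), fun h =>
    h.of_addEquiv e (fun _ _ _ => rfl) fun _ _ => rfl⟩
  all_goals
    obtain ⟨a, rfl⟩ := Ideal.Quotient.mk_surjective y
    rfl

/-- A homogeneous regular sequence of maximal length cuts out an algebra of finite length. -/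
theorem IsHomogeneousRegular.exists_forall_le [IsNoetherianRing A] [Nontrivial A]
    (hstd : IsStandardGraded 𝒜) {n : ℕ} {x : Fin n → A} (hx : IsLinearGenerators 𝒜 x)
    {l : List (A × ℕ)} {J : Ideal A} (h : IsHomogeneousRegular 𝒜 ⊥ l J)
    (hl : (l.length : ℕ∞) = (HomogeneousIdeal.irrelevant 𝒜).toIdeal.height) :
    ∃ N, ∀ j ≥ N, ∀ a ∈ 𝒜 j, a ∈ J := by
  set 𝔪 := (HomogeneousIdeal.irrelevant 𝒜).toIdeal with h𝔪
  have hmax : 𝔪.IsMaximal := irrelevant_isMaximal hstd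
  have hJ := h.isHomogeneous (Ideal.IsHomogeneous.bot 𝒜)
  -- A minimal prime `p` of `J` equals its homogeneous core, so it lies in `𝔪`. It has height at
  -- least `l.length = ht 𝔪`, so it cannot be strictly smaller.
  have hrad : 𝔪 ≤ J.radical := by
    rw [← Ideal.sInf_minimalPrimes]
    refine le_sInf fun p hp => ?_
    have hpp : p.IsPrime := hp.1.1
    have hcore : (p.homogeneousCore 𝒜).toIdeal.IsPrime := hpp.homogeneousCore
    have hcoreJ : J ≤ (p.homogeneousCore 𝒜).toIdeal := by
      rw [← hJ.toIdeal_homogeneousCore_eq_self]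
      exact Ideal.homogeneousCore_mono 𝒜 hp.1.2
    have hpcore : p ≤ (p.homogeneousCore 𝒜).toIdeal :=
      hp.2 ⟨hcore, hcoreJ⟩ (Ideal.toIdeal_homogeneousCore_le 𝒜 p)
    have hp𝔪 : p ≤ 𝔪 := hpcore.trans
      (le_irrelevant_of_isHomogeneous hstd (p.homogeneousCore 𝒜).isHomogeneous hcore.ne_top)
    obtain ⟨q, _, _, hq⟩ := h.height_le p hp.1.2
    by_contra hne
    have h₁ := Ideal.height_add_one_le_of_lt_of_isPrime
      (lt_of_le_of_ne hp𝔪 fun h' => hne h'.ge)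
    have h₂ : (l.length : ℕ∞) + 1 ≤ l.length :=
      calc (l.length : ℕ∞) + 1 ≤ p.height + 1 := by gcongr; exact le_add_self.trans hq
        _ ≤ 𝔪.height := h₁
        _ = l.length := hl.symm
    norm_cast at h₂
    omega
  obtain ⟨N, hN⟩ := Ideal.exists_pow_le_of_le_radical_of_fg hrad (IsNoetherian.noetherian 𝔪)
  exact ⟨N, fun j hj a ha => hN (Ideal.pow_le_pow_right hj (mem_irrelevant_pow hx ha))⟩

theorem exists_top_degree [Nontrivial A] {J : Ideal A}
    (hJ : J ≤ (HomogeneousIdeal.irrelevant 𝒜).toIdeal) {N : ℕ} (hN : ∀ j ≥ N, ∀ a ∈ 𝒜 j, a ∈ J) :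
    ∃ t, (∃ b ∈ 𝒜 t, b ∉ J) ∧ ∀ j > t, ∀ a ∈ 𝒜 j, a ∈ J := by
  classical
  let P : ℕ → Prop := fun t => ∃ b ∈ 𝒜 t, b ∉ J
  have h0 : P 0 := ⟨1, SetLike.GradedOne.one_mem, fun h =>
    irrelevant_ne_top ((Ideal.eq_top_iff_one _).2 (hJ h))⟩
  refine ⟨Nat.findGreatest P N, Nat.findGreatest_spec (Nat.zero_le N) h0, fun j hj a ha => ?_⟩
  by_contra haJ
  rcases lt_or_ge j N with hjN | hjN
  · exact Nat.findGreatest_is_greatest hj hjN.le ⟨a, ha, haJ⟩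
  · exact haJ (hN j hjN a ha)

/-- The differences of the bidegrees of the nonvanishing Koszul homology of `A ⧸ I`. -/
def koszulDegrees {n : ℕ} (x : Fin n → A) {I : Ideal A} (hI : I.IsHomogeneous 𝒜) : Set ℤ :=
  {d | ∃ p j : ℤ, ¬ KoszulVanishes (extendByZero x) n (quotientProj hI) p j ∧ d = j - p}

/-- An element of top degree `t` is killed by all `x i` and gives a class in bidegree `(n, t + n)`.
No chain has `j - p > t`, as this is the degree of its coefficients. -/
theorem isGreatest_koszulDegrees_of_finite {n : ℕ} {x : Fin n → A} (hx : ∀ i, x i ∈ 𝒜 1)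
    {J : Ideal A} (hJ : J.IsHomogeneous 𝒜) {t : ℕ} (ht : ∃ b ∈ 𝒜 t, b ∉ J)
    (ht' : ∀ j > t, ∀ a ∈ 𝒜 j, a ∈ J) : IsGreatest (koszulDegrees x hJ) t := by
  constructor
  · obtain ⟨b, hb, hbJ⟩ := ht
    refine ⟨n, t + n, fun h => hbJ ?_, by ring⟩
    rw [← Ideal.Quotient.eq_zero_iff_mem]
    refine h.eq_zero_of_smul_eq_zero (isGradingProj_quotientProj hx hJ) ?_ fun i hi => ?_
    · rw [quotientProj_mk, gradedProj_of_mem_same hb]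
    · rw [extendByZero_val x ⟨i, hi⟩]
      exact Ideal.Quotient.eq_zero_iff_mem.2
        (ht' (1 + t) (by omega) _ (SetLike.mul_mem_graded (hx _) hb))
  · rintro d ⟨p, j, h, rfl⟩
    by_contra! hlt
    refine h (koszulVanishes_of_degree (c := t) (fun i hi => ?_) hlt)
    ext y
    obtain ⟨a, rfl⟩ := Ideal.Quotient.mk_surjective y
    rw [quotientProj_mk]
    refine Ideal.Quotient.eq_zero_iff_mem.2 ?_
    lift i to ℕ using by omega
    exact ht' i (by exact_mod_cast hi) _ (gradedProj_natCast_mem i a)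

/-- The bidegrees for the quotient are those for `A ⧸ I` together with their translates by `(1, e)`.
Translation raises `j - p` by `e - 1 ≥ 0`, and so does passage to the maximum. -/
theorem isGreatest_koszulDegrees_of_sup_span {n : ℕ} {x : Fin n → A}
    (hx : IsLinearGenerators 𝒜 x) {I : Ideal A} (hI : I.IsHomogeneous 𝒜) {e : ℕ} (he : 0 < e)
    {θ : A} (hθ : θ ∈ 𝒜 e) (hreg : ∀ a, θ * a ∈ I → a ∈ I) {s : ℤ}
    (h : IsGreatest (koszulDegrees x (isHomogeneous_sup_span_singleton hI hθ)) s) :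
    IsGreatest (koszulDegrees x hI) (s - e + 1) := by
  have hmem : ∀ p j, ¬ KoszulVanishes (extendByZero x) n (quotientProj hI) p j →
      j - p + e - 1 ≤ s := fun p j hpj => by
    refine h.2 ⟨p + 1, j + e, ?_, by ring⟩
    rw [koszulVanishes_sup_span_iff hx hI he hθ hreg, add_sub_cancel_right, add_sub_cancel_right]
    exact fun h' => hpj h'.2
  constructor
  · obtain ⟨p, j, hpj, rfl⟩ := h.1
    rw [koszulVanishes_sup_span_iff hx hI he hθ hreg, not_and_or] at hpj
    rcases hpj with hpj | hpj
    -- If the maximum is already attained by an untranslated bidegree, the bound forces `e = 1`.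
    · have := hmem p j hpj
      exact ⟨p, j, hpj, by omega⟩
    · exact ⟨p - 1, j - e, hpj, by ring⟩
  · rintro d ⟨p, j, hpj, rfl⟩
    have := hmem p j hpj
    omega

theorem IsHomogeneousRegular.isGreatest_koszulDegrees {n : ℕ} {x : Fin n → A}
    (hx : IsLinearGenerators 𝒜 x) {I J : Ideal A} {l : List (A × ℕ)}
    (h : IsHomogeneousRegular 𝒜 I l J) (hI : I.IsHomogeneous 𝒜) (hJ : J.IsHomogeneous 𝒜) {t : ℤ}
    (ht : IsGreatest (koszulDegrees x hJ) t) :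
    IsGreatest (koszulDegrees x hI) (t - (l.map Prod.snd).sum + l.length) := by
  induction h with
  | nil => simpa using ht
  | @cons I J θ e l mem pos reg tail ih =>
    have := isGreatest_koszulDegrees_of_sup_span hx hI pos mem reg
      (ih (isHomogeneous_sup_span_singleton hI mem) hJ ht)
    convert this using 1
    rw [List.map_cons, List.sum_cons, List.length_cons]
    push_cast
    ring

/-- The regularity is the greatest difference of the bidegrees of the Koszul homology. -/
theorem hasRegularity_of_isGreatest [Nontrivial A] [Algebra.FiniteType K A]
    (hstd : IsStandardGraded 𝒜) {r : ℤ}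
    (h : ∀ (n : ℕ) (x : Fin n → A), IsLinearGenerators 𝒜 x →
      IsGreatest (koszulDegrees x (Ideal.IsHomogeneous.bot 𝒜)) r) : HasRegularity 𝒜 r := by
  refine ⟨exists_isLinearGenerators hstd, fun n x hx =>
    ⟨nonempty_minimalGradedFreeResolution hx, fun P => ?_⟩⟩
  have hdeg : P.regularityDegrees = koszulDegrees x (Ideal.IsHomogeneous.bot 𝒜) := by
    ext d
    constructor
    · rintro ⟨i, k, rfl⟩
      refine ⟨i, P.shift i k, ?_, rfl⟩
      rw [koszulVanishes_quotient_bot_iff, P.koszulVanishes_iff hx.mem]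
      exact fun h => h k rfl
    · rintro ⟨p, j, hpj, rfl⟩
      have hp : 0 ≤ p := by
        by_contra! hp
        exact hpj (koszulVanishes_of_neg hp)
      lift p to ℕ using hp
      rw [koszulVanishes_quotient_bot_iff, P.koszulVanishes_iff hx.mem] at hpj
      push Not at hpj
      obtain ⟨k, hk⟩ := hpj
      exact ⟨p, k, by rw [hk]⟩
  rw [hdeg]
  exact h n x hx

end RegularityOfCohenMacaulay

/-! ### Hilbert series modulo a regular sequence and the a-invariant -/

section HilbertSeries

variable {K A : Type*} [Field K] [CommRing A] [Algebra K A] {𝒜 : ℕ → Submodule K A}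

/-- The part of degree `j` of `A ⧸ I`. -/
def quotientPart (𝒜 : ℕ → Submodule K A) (I : Ideal A) (j : ℕ) : Submodule K (A ⧸ I) :=
  (𝒜 j).map (Ideal.Quotient.mkₐ K I).toLinearMap

/-- The Hilbert series of `A ⧸ I`. -/
noncomputable def quotientHilbertSeries (𝒜 : ℕ → Submodule K A) (I : Ideal A) : PowerSeries ℚ :=
  PowerSeries.mk fun j => (Module.finrank K (quotientPart 𝒜 I j) : ℚ)

theorem quotientHilbertSeries_bot :
    quotientHilbertSeries 𝒜 (⊥ : Ideal A) = hilbertSeries 𝒜 := by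
  ext j
  rw [quotientHilbertSeries, hilbertSeries, PowerSeries.coeff_mk, PowerSeries.coeff_mk]
  have hinj : Function.Injective (Ideal.Quotient.mkₐ K (⊥ : Ideal A)).toLinearMap := fun a b h =>
    sub_eq_zero.1 ((Submodule.mem_bot A).1 (Ideal.Quotient.eq.1 h))
  rw [quotientPart, ← (Submodule.equivMapOfInjective _ hinj (𝒜 j)).finrank_eq]

theorem finrank_map_add_finrank_inf_ker {V W : Type*} [AddCommGroup V] [Module K V]
    [AddCommGroup W] [Module K W] (g : V →ₗ[K] W) (U : Submodule K V) [FiniteDimensional K U] :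
    Module.finrank K (U.map g) + Module.finrank K (U ⊓ LinearMap.ker g : Submodule K V) =
      Module.finrank K U := by
  rw [← LinearMap.finrank_range_add_finrank_ker (g.domRestrict U), LinearMap.range_domRestrict,
    LinearMap.ker_domRestrict, ← Submodule.map_comap_subtype,
    (Submodule.equivMapOfInjective U.subtype U.injective_subtype _).finrank_eq]

variable [GradedAlgebra 𝒜]

/-- Dimension count in each degree of `0 → (A/I)(-e) → A/I → A/(I + (θ)) → 0`. -/
theorem quotientHilbertSeries_sup_span {n : ℕ} {x : Fin n → A} (hx : IsLinearGenerators 𝒜 x)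
    {I : Ideal A} (hI : I.IsHomogeneous 𝒜) {e : ℕ} {θ : A} (hθ : θ ∈ 𝒜 e)
    (hreg : ∀ a, θ * a ∈ I → a ∈ I) :
    (1 - PowerSeries.X ^ e) * quotientHilbertSeries 𝒜 I =
      quotientHilbertSeries 𝒜 (I ⊔ Ideal.span {θ}) := by
  have hfin := finiteDimensional_graded hx
  ext j
  rw [sub_mul, one_mul, map_sub, PowerSeries.coeff_X_pow_mul', sub_eq_iff_eq_add]
  simp only [quotientHilbertSeries, PowerSeries.coeff_mk]
  have hle : I ≤ I ⊔ Ideal.span {θ} := le_sup_left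
  let g : (A ⧸ I) →ₗ[K] A ⧸ (I ⊔ Ideal.span {θ}) := (Ideal.Quotient.factorₐ K hle).toLinearMap
  let f : (A ⧸ I) →ₗ[K] A ⧸ I := LinearMap.mulLeft K (Ideal.Quotient.mk I θ)
  have hf : Function.Injective f := isSMulRegular_quotient hreg
  have : FiniteDimensional K (quotientPart 𝒜 I j) := by
    rw [quotientPart]; infer_instance
  have hmap : (quotientPart 𝒜 I j).map g = quotientPart 𝒜 (I ⊔ Ideal.span {θ}) j := by
    rw [quotientPart, quotientPart, ← Submodule.map_comp]
    rfl
  -- A multiple `θ b` that is homogeneous of degree `j` equals `θ` times the component of `b` in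
  -- degree `j - e`, which is zero when `j < e`.
  have hker : (quotientPart 𝒜 I j ⊓ LinearMap.ker g : Submodule K (A ⧸ I)) =
      if e ≤ j then (quotientPart 𝒜 I (j - e)).map f else ⊥ := by
    ext y
    constructor
    · rintro ⟨⟨a, ha, rfl⟩, hy⟩
      obtain ⟨z, hz⟩ := (exact_smul_factor I θ _).1 hy
      obtain ⟨b, rfl⟩ := Ideal.Quotient.mk_surjective z
      have h₁ := congrArg (quotientProj hI j) hz
      rw [quotientProj_smul hI hθ, quotientProj_mk] at h₁
      change _ = quotientProj hI j (Ideal.Quotient.mk I a) at h₁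
      rw [quotientProj_mk, gradedProj_of_mem_same ha] at h₁
      change Ideal.Quotient.mk I a ∈ _
      rw [← h₁]
      split_ifs with hej
      · rw [← Nat.cast_sub hej]
        exact ⟨_, ⟨_, gradedProj_natCast_mem (j - e) b, rfl⟩, rfl⟩
      · rw [gradedProj_of_neg 𝒜 (by omega), LinearMap.zero_apply, map_zero, smul_zero]
        exact Submodule.zero_mem _
    · split_ifs with hej
      · rintro ⟨_, ⟨b, hb, rfl⟩, rfl⟩
        refine ⟨⟨θ * b, ?_, rfl⟩, ?_⟩
        · have := SetLike.mul_mem_graded hθ hb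
          rwa [Nat.add_sub_cancel' hej] at this
        · exact (exact_smul_factor I θ _).2 ⟨Ideal.Quotient.mk I b, rfl⟩
      · intro hy
        rw [(Submodule.mem_bot K).1 hy]
        exact Submodule.zero_mem _
  have h := finrank_map_add_finrank_inf_ker g (quotientPart 𝒜 I j)
  rw [hmap, hker] at h
  rw [← h]
  by_cases hej : e ≤ j
  · rw [if_pos hej, if_pos hej, ← (Submodule.equivMapOfInjective f hf _).finrank_eq, Nat.cast_add]
  · rw [if_neg hej, if_neg hej, finrank_bot, add_zero, add_zero]

/-- The polynomial `q` is the product of the `1 - X ^ e` over the degrees `e` in `l`. -/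
theorem IsHomogeneousRegular.exists_mul_quotientHilbertSeries {n : ℕ} {x : Fin n → A}
    (hx : IsLinearGenerators 𝒜 x) {I J : Ideal A} {l : List (A × ℕ)}
    (h : IsHomogeneousRegular 𝒜 I l J) (hI : I.IsHomogeneous 𝒜) :
    ∃ q : Polynomial ℚ, q ≠ 0 ∧ q.natDegree = (l.map Prod.snd).sum ∧
      (q : PowerSeries ℚ) * quotientHilbertSeries 𝒜 I = quotientHilbertSeries 𝒜 J := by
  induction h with
  | nil => exact ⟨1, one_ne_zero, by simp, by simp⟩
  | @cons I J θ e l mem pos reg tail ih =>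
    obtain ⟨q, hq, hdeg, heq⟩ := ih (isHomogeneous_sup_span_singleton hI mem)
    have hd : (1 - Polynomial.X ^ e : Polynomial ℚ).natDegree = e := by
      rw [Polynomial.natDegree_sub, ← Polynomial.C_1, Polynomial.natDegree_X_pow_sub_C]
    have hne : (1 - Polynomial.X ^ e : Polynomial ℚ) ≠ 0 := by
      intro h0
      rw [h0, Polynomial.natDegree_zero] at hd
      omega
    refine ⟨q * (1 - Polynomial.X ^ e), mul_ne_zero hq hne, ?_, ?_⟩
    · rw [Polynomial.natDegree_mul hq hne, hd, hdeg, List.map_cons, List.sum_cons, add_comm]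
    · rw [← heq, ← quotientHilbertSeries_sup_span hx hI mem reg, ← mul_assoc]
      simp

theorem exists_quotientHilbertSeries_eq {n : ℕ} {x : Fin n → A} (hx : IsLinearGenerators 𝒜 x)
    {J : Ideal A} {t : ℕ} (ht : ∃ b ∈ 𝒜 t, b ∉ J) (ht' : ∀ j > t, ∀ a ∈ 𝒜 j, a ∈ J) :
    ∃ p : Polynomial ℚ, p ≠ 0 ∧ p.natDegree = t ∧
      (p : PowerSeries ℚ) = quotientHilbertSeries 𝒜 J := by
  have hfin := finiteDimensional_graded hx
  have hcoeff : ∀ j > t, PowerSeries.coeff j (quotientHilbertSeries 𝒜 J) = 0 := fun j hj => by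
    have : quotientPart 𝒜 J j = ⊥ := by
      rw [eq_bot_iff]
      rintro _ ⟨a, ha, rfl⟩
      exact Ideal.Quotient.eq_zero_iff_mem.2 (ht' j hj a ha)
    rw [quotientHilbertSeries, PowerSeries.coeff_mk, this, finrank_bot, Nat.cast_zero]
  have htop : PowerSeries.coeff t (quotientHilbertSeries 𝒜 J) ≠ 0 := by
    obtain ⟨b, hb, hbJ⟩ := ht
    have : FiniteDimensional K (quotientPart 𝒜 J t) := by
      rw [quotientPart]; infer_instance
    rw [quotientHilbertSeries, PowerSeries.coeff_mk, Nat.cast_ne_zero, Ne,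
      Submodule.finrank_eq_zero]
    intro h
    have hmem : Ideal.Quotient.mkₐ K J b ∈ quotientPart 𝒜 J t := ⟨b, hb, rfl⟩
    rw [h] at hmem
    exact hbJ (Ideal.Quotient.eq_zero_iff_mem.1 hmem)
  have hp : ∀ j, (PowerSeries.trunc (t + 1) (quotientHilbertSeries 𝒜 J)).coeff j =
      PowerSeries.coeff j (quotientHilbertSeries 𝒜 J) := fun j => by
    rw [PowerSeries.coeff_trunc]
    split_ifs with h
    · rfl
    · exact (hcoeff j (by omega)).symm
  refine ⟨PowerSeries.trunc (t + 1) (quotientHilbertSeries 𝒜 J), fun h => htop ?_, ?_, ?_⟩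
  · rw [← hp, h, Polynomial.coeff_zero]
  · refine Polynomial.natDegree_eq_of_le_of_coeff_ne_zero ?_ (by rwa [hp])
    exact Polynomial.natDegree_le_iff_coeff_eq_zero.2 fun j hj => by rw [hp, hcoeff j hj]
  · ext j
    rw [Polynomial.coeff_coe, hp]

theorem hasAInvariant_of_isHomogeneousRegular {n : ℕ} {x : Fin n → A}
    (hx : IsLinearGenerators 𝒜 x) {l : List (A × ℕ)} {J : Ideal A}
    (h : IsHomogeneousRegular 𝒜 ⊥ l J) {t : ℕ} (ht : ∃ b ∈ 𝒜 t, b ∉ J)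
    (ht' : ∀ j > t, ∀ a ∈ 𝒜 j, a ∈ J) :
    HasAInvariant 𝒜 ((t : ℤ) - (l.map Prod.snd).sum) := by
  obtain ⟨q, hq, hqdeg, hqeq⟩ :=
    h.exists_mul_quotientHilbertSeries hx (Ideal.IsHomogeneous.bot 𝒜)
  obtain ⟨p, hp, hpdeg, hpeq⟩ := exists_quotientHilbertSeries_eq hx ht ht'
  exact ⟨p, q, hp, hq, by rw [← quotientHilbertSeries_bot, hqeq, hpeq], by rw [hpdeg, hqdeg]⟩

/-- In a Cohen-Macaulay standard graded algebra there is a homogeneous regular sequence `l`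
generating an ideal of finite colength, and it computes the `a`-invariant and the regularity. -/
theorem exists_isHomogeneousRegular_of_isCohenMacaulay [Nontrivial A] [Algebra.FiniteType K A]
    (hstd : IsStandardGraded 𝒜) (hCM : IsCohenMacaulay A) :
    ∃ (l : List (A × ℕ)) (J : Ideal A) (t : ℕ), IsHomogeneousRegular 𝒜 ⊥ l J ∧ J ≠ ⊤ ∧
      (∀ j > t, ∀ a ∈ 𝒜 j, a ∈ J) ∧
      HasAInvariant 𝒜 ((t : ℤ) - (l.map Prod.snd).sum) ∧
      HasRegularity 𝒜 ((t : ℤ) - (l.map Prod.snd).sum + l.length) := by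
  have := hCM.noetherian
  obtain ⟨n, x, hx⟩ := exists_isLinearGenerators hstd
  obtain ⟨rs, hrs, hreg, hlen⟩ := hCM.exists_regular _ (irrelevant_isMaximal hstd)
  obtain ⟨l, J, hl, hlk⟩ := exists_isHomogeneousRegular hx rs.length ⊥ fun p hp => by
    refine KoszulVanishes.of_addEquiv (x := extendByZero x) (π := fun _ => AddMonoidHom.id A)
      (RingEquiv.quotientBot A).symm.toAddEquiv (fun _ _ _ => rfl) (fun _ _ => rfl) ?_
    exact koszulVanishes_of_isWeaklyRegular rs A
      (fun r hr => mem_span_extendByZero hx (hrs r hr)) hreg.toIsWeaklyRegular p hp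
  have hJle := hl.le_irrelevant bot_le
  obtain ⟨N, hN⟩ := hl.exists_forall_le hstd hx (by rw [hlk, hlen])
  obtain ⟨t, ht, ht'⟩ := exists_top_degree hJle hN
  refine ⟨l, J, t, hl, fun h => irrelevant_ne_top (top_le_iff.1 (h ▸ hJle)), ht',
    hasAInvariant_of_isHomogeneousRegular hx hl ht ht',
    hasRegularity_of_isGreatest hstd fun m y hy => ?_⟩
  -- The sequence was found by means of `x`, but `l`, `J` and `t` make no reference to it, so every
  -- family `y` of linear generators gives the same value.
  have hJ := hl.isHomogeneous (Ideal.IsHomogeneous.bot 𝒜)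
  have hg := isGreatest_koszulDegrees_of_finite hy.mem hJ ht ht'
  exact hl.isGreatest_koszulDegrees hy _ hJ hg

end HilbertSeries

/-! ### The regular sequence as a transcendence basis -/

section TranscendenceDegree

open MvPolynomial

variable {K A : Type*} [Field K] [CommRing A] [Algebra K A] {𝒜 : ℕ → Submodule K A}

theorem aeval_eq_eval₂_finSuccEquiv {m : ℕ} (y : Fin (m + 1) → A)
    (f : MvPolynomial (Fin (m + 1)) K) :
    aeval y f = (finSuccEquiv K m f).eval₂ (aeval fun i => y i.succ).toRingHom (y 0) := by
  induction f using MvPolynomial.induction_on with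
  | C a =>
    have h' : finSuccEquiv K m (C a) = Polynomial.C (C a) := (finSuccEquiv K m).commutes a
    rw [h', Polynomial.eval₂_C, aeval_C]
    exact (aeval_C (fun i : Fin m => y i.succ) a).symm
  | add p q hp hq => rw [map_add, map_add, Polynomial.eval₂_add, hp, hq]
  | mul_X p i hp =>
    rw [map_mul, map_mul, Polynomial.eval₂_mul, hp, aeval_X]
    congr 1
    refine Fin.cases ?_ (fun i => ?_) i
    · rw [finSuccEquiv_X_zero, Polynomial.eval₂_X]
    · rw [finSuccEquiv_X_succ, Polynomial.eval₂_C]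
      exact (aeval_X (fun i : Fin m => y i.succ) i).symm

/-- Read a relation as a polynomial in the first element `θ`. Its constant term is a relation modulo
`I + (θ)`, so it vanishes by induction; then `θ` factors out and is cancelled by regularity. -/
theorem IsHomogeneousRegular.eq_zero_of_aeval_mem {I J : Ideal A} {l : List (A × ℕ)}
    (h : IsHomogeneousRegular 𝒜 I l J) (hJ : J ≠ ⊤) (f : MvPolynomial (Fin l.length) K)
    (hf : aeval (fun i => (l.get i).1) f ∈ I) : f = 0 := by
  induction h with
  | nil I =>
    obtain ⟨c, rfl⟩ := C_surjective (Fin 0) f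
    by_contra hc
    rw [aeval_C] at hf
    refine hJ (I.eq_top_of_isUnit_mem hf ((IsUnit.mk0 c ?_).map _))
    rintro rfl
    exact hc C_0
  | @cons I J θ e l mem pos reg tail ih =>
    have ih' := ih hJ
    rw [aeval_eq_eval₂_finSuccEquiv] at hf
    rw [← (finSuccEquiv K l.length).map_eq_zero_iff]
    change (finSuccEquiv K l.length f).eval₂ (aeval fun i => (l.get i).1).toRingHom θ ∈ I at hf
    generalize finSuccEquiv K l.length f = p at hf ⊢
    induction p using Polynomial.recOnHorner with
    | M0 => rfl
    | MC p a hp ha _ =>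
      refine absurd (ih' a ?_) ha
      rw [← p.divX_mul_X_add, hp, map_zero, add_zero, Polynomial.eval₂_add, Polynomial.eval₂_mul,
        Polynomial.eval₂_X, Polynomial.eval₂_C] at hf
      refine (Ideal.add_mem_iff_right _ ?_).1 (Ideal.mem_sup_left hf)
      exact Ideal.mem_sup_right (Ideal.mul_mem_left _ _ (Ideal.mem_span_singleton_self θ))
    | MX p _ hp =>
      rw [Polynomial.eval₂_mul, Polynomial.eval₂_X, mul_comm] at hf
      rw [hp (reg _ hf), zero_mul]

theorem IsHomogeneousRegular.mem_graded {I J : Ideal A} {l : List (A × ℕ)}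
    (h : IsHomogeneousRegular 𝒜 I l J) : ∀ i, (l.get i).1 ∈ 𝒜 (l.get i).2 ∧ 0 < (l.get i).2 := by
  induction h with
  | nil => exact fun i => i.elim0
  | cons mem pos _ _ ih => exact fun i => Fin.cases ⟨mem, pos⟩ ih i

theorem IsHomogeneousRegular.eq_sup_span {I J : Ideal A} {l : List (A × ℕ)}
    (h : IsHomogeneousRegular 𝒜 I l J) :
    J = I ⊔ Ideal.span (Set.range fun i => (l.get i).1) := by
  induction h with
  | nil =>
    have : IsEmpty (Fin ([] : List (A × ℕ)).length) := inferInstanceAs (IsEmpty (Fin 0))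
    rw [Set.range_eq_empty, Ideal.span_empty, sup_bot_eq]
  | @cons I J θ e l mem pos reg tail ih =>
    have hr : (Set.range fun i => (((θ, e) :: l).get i).1) =
        {θ} ∪ Set.range fun i => (l.get i).1 := by
      ext a
      constructor
      · rintro ⟨i, rfl⟩
        exact Fin.cases (Or.inl rfl) (fun i => Or.inr ⟨i, rfl⟩) i
      · rintro (rfl | ⟨i, rfl⟩)
        · exact ⟨0, rfl⟩
        · exact ⟨i.succ, rfl⟩
    rw [ih, hr, Ideal.span_union, sup_assoc]

/-- Graded Nakayama: an algebra of finite length modulo homogeneous elements of positive degree is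
finite over the subalgebra they generate. -/
theorem finite_adjoin_of_forall_mem_span [GradedAlgebra 𝒜] (hfin : ∀ i, FiniteDimensional K (𝒜 i))
    {k : ℕ} {θ : Fin k → A} {e : Fin k → ℕ} (hθ : ∀ i, θ i ∈ 𝒜 (e i) ∧ 0 < e i) {t : ℕ}
    (ht : ∀ j > t, ∀ a ∈ 𝒜 j, a ∈ Ideal.span (Set.range θ)) :
    Module.Finite (Algebra.adjoin K (Set.range θ)) A := by
  classical
  set B := Algebra.adjoin K (Set.range θ)
  choose s hs using fun i => Module.Finite.iff_fg.1 (hfin i)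
  set N : Submodule B A := Submodule.span B ((Finset.range (t + 1)).biUnion s : Finset A) with hN
  have hsmall : ∀ i ≤ t, ∀ a ∈ 𝒜 i, a ∈ N := by
    intro i hi a ha
    rw [← hs i] at ha
    refine Submodule.span_subset_span K B _ (Submodule.span_mono (fun b hb => ?_) ha)
    exact Finset.mem_biUnion.2 ⟨i, Finset.mem_range.2 (by omega), hb⟩
  have hall : ∀ j, ∀ a ∈ 𝒜 j, a ∈ N := by
    intro j
    induction j using Nat.strong_induction_on with
    | _ j ih =>
      intro a ha
      rcases le_or_gt j t with hj | hj
      · exact hsmall j hj a ha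
      · obtain ⟨c, hc⟩ := Ideal.mem_span_range_iff_exists_fun.1 (ht j hj a ha)
        -- Projecting to degree `j` replaces the coefficient of `θ i` by its part of degree `j - e i
        -- < j`, to which the induction applies.
        rw [← gradedProj_of_mem_same ha, ← hc, map_sum]
        refine Submodule.sum_mem _ fun i _ => ?_
        rw [mul_comm, gradedProj_mul (hθ i).1]
        have hθB : θ i ∈ B := Algebra.subset_adjoin ⟨i, rfl⟩
        refine Submodule.smul_mem N (⟨θ i, hθB⟩ : B) ?_
        rcases lt_or_ge j (e i) with h | h
        · rw [gradedProj_of_neg 𝒜 (by omega)]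
          exact Submodule.zero_mem _
        · rw [← Nat.cast_sub h]
          have := (hθ i).2
          exact ih (j - e i) (by omega) _ (gradedProj_natCast_mem _ _)
  refine ⟨⟨(Finset.range (t + 1)).biUnion s, eq_top_iff.2 fun a _ => ?_⟩⟩
  rw [← DirectSum.sum_support_decompose 𝒜 a]
  exact Submodule.sum_mem _ fun i _ => hall i _ (SetLike.coe_mem _)

theorem IsHomogeneousRegular.isTranscendenceBasis [GradedAlgebra 𝒜] [IsDomain A]
    (hfin : ∀ i, FiniteDimensional K (𝒜 i)) {l : List (A × ℕ)} {J : Ideal A}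
    (h : IsHomogeneousRegular 𝒜 ⊥ l J) (hJ : J ≠ ⊤) {t : ℕ} (ht : ∀ j > t, ∀ a ∈ 𝒜 j, a ∈ J) :
    IsTranscendenceBasis K fun i => (l.get i).1 := by
  rw [isTranscendenceBasis_iff_algebraicIndependent_isAlgebraic]
  constructor
  · rw [algebraicIndependent_iff]
    exact fun f hf => h.eq_zero_of_aeval_mem hJ f (hf ▸ Submodule.zero_mem _)
  · rw [h.eq_sup_span, bot_sup_eq] at ht
    have := finite_adjoin_of_forall_mem_span hfin h.mem_graded ht
    infer_instance

end TranscendenceDegree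

/-! ### The rank of the exponent matrix as a transcendence degree -/

section MonomialSubring

open MvPolynomial

variable {K : Type*} [Field K] {s m : ℕ}

/-- Monomials with linearly independent exponents are algebraically independent. -/
theorem algebraicIndependent_monomial {κ : Type*} [Finite κ] (w : κ → Fin s →₀ ℕ)
    (hw : LinearIndependent ℚ fun k j => (w k j : ℚ)) :
    AlgebraicIndependent K fun k => monomial (w k) (1 : K) := by
  classical
  have := Fintype.ofFinite κ
  -- Substitution sends the monomial with exponent `u` to the one with exponent `φ u`; injectivity
  -- of `φ` prevents cancellation.
  let φ : (κ →₀ ℕ) → (Fin s →₀ ℕ) := fun u => ∑ k, u k • w k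
  have hφ : Function.Injective φ := by
    intro u u' h
    have h' : ∑ k, ((u k : ℚ) - u' k) • (fun j => (w k j : ℚ)) = 0 := by
      ext j
      have hj := congrArg (fun z : Fin s →₀ ℕ => (z j : ℚ)) h
      simp only [φ, Finsupp.finsetSum_apply, Finsupp.smul_apply, smul_eq_mul, Nat.cast_sum,
        Nat.cast_mul] at hj
      simp only [Finset.sum_apply, Pi.smul_apply, smul_eq_mul, sub_mul, Finset.sum_sub_distrib, hj,
        sub_self, Pi.zero_apply]
    ext k
    have := Fintype.linearIndependent_iff.1 hw _ h' k
    exact_mod_cast sub_eq_zero.1 this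
  rw [algebraicIndependent_iff]
  intro f hf
  have haeval : aeval (fun k => monomial (w k) (1 : K)) f =
      ∑ u ∈ f.support, monomial (φ u) (coeff u f) := by
    conv_lhs => rw [f.as_sum]
    rw [map_sum]
    refine Finset.sum_congr rfl fun u _ => ?_
    rw [aeval_monomial, Finsupp.prod_fintype _ _ fun k => pow_zero _]
    simp only [monomial_pow, one_pow]
    rw [← monomial_sum_one, algebraMap_eq, C_mul_monomial, mul_one]
  ext u
  have hu := congrArg (coeff (φ u)) hf
  rw [haeval, coeff_sum, coeff_zero] at hu
  simp only [coeff_monomial, hφ.eq_iff] at hu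
  rw [Finset.sum_ite_eq' f.support u] at hu
  rw [coeff_zero]
  by_contra hne
  rw [if_pos (mem_support_iff.2 hne)] at hu
  exact hne hu

/-- The generators of the monomial subring. -/
noncomputable def monomialGenerator (K : Type*) [Field K] (v : Fin m → (Fin s →₀ ℕ)) (i : Fin m) :
    monomialSubring K v :=
  ⟨monomial (v i) 1, Algebra.subset_adjoin ⟨i, rfl⟩⟩

theorem adjoin_range_monomialGenerator (v : Fin m → (Fin s →₀ ℕ)) :
    Algebra.adjoin K (Set.range (monomialGenerator K v)) = ⊤ := by
  refine Eq.trans ?_ (Algebra.adjoin_adjoin_coe_preimage (R := K)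
    (s := Set.range fun i => monomial (v i) (1 : K)))
  congr 1
  ext a
  constructor
  · rintro ⟨i, rfl⟩
    exact ⟨i, rfl⟩
  · rintro ⟨i, hi⟩
    exact ⟨i, Subtype.ext hi⟩

/-- Clear denominators in a rational combination and move the negative coefficients to the other
side. -/
theorem exists_nat_relation {κ : Type*} [Fintype κ] (w : κ → Fin s →₀ ℕ) (z : Fin s →₀ ℕ)
    (hz : (fun j => (z j : ℚ)) ∈ Submodule.span ℚ (Set.range fun k j => (w k j : ℚ))) :
    ∃ (N : ℕ) (b c : κ → ℕ), 0 < N ∧ N • z + ∑ k, b k • w k = ∑ k, c k • w k := by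
  obtain ⟨q, hq⟩ := (Submodule.mem_span_range_iff_exists_fun ℚ).1 hz
  obtain ⟨N, hN⟩ := IsLocalization.exist_integer_multiples_of_finite (nonZeroDivisors ℤ) q
  choose c hc using hN
  have hN0 : (N : ℤ) ≠ 0 := nonZeroDivisors.coe_ne_zero N
  have hpos : 0 < (N : ℤ) * N := mul_self_pos.2 hN0
  -- The common denominator `N` is only a nonzero integer; multiplying by it once more gives the
  -- positive multiplier `N * N`.
  refine ⟨((N : ℤ) * N).toNat, fun k => (-(N * c k)).toNat, fun k => (N * c k).toNat,
    by omega, ?_⟩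
  ext j
  have hj := congrFun hq j
  have hc' : ∀ k, (c k : ℚ) = (N : ℤ) * q k := fun k => by
    have := hc k
    rw [zsmul_eq_mul] at this
    exact this
  have hsplit : ∀ k, (((N * c k : ℤ).toNat : ℕ) : ℚ) =
      (((-(N * c k) : ℤ).toNat : ℕ) : ℚ) + (N : ℤ) * (N : ℤ) * q k := fun k => by
    rw [mul_assoc, ← hc']
    have := Int.toNat_sub_toNat_neg (N * c k)
    rw [sub_eq_iff_eq_add, add_comm] at this
    exact_mod_cast this
  have hD : ((((N : ℤ) * N).toNat : ℕ) : ℚ) = (N : ℤ) * (N : ℤ) := by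
    have := Int.toNat_of_nonneg hpos.le
    exact_mod_cast this
  rw [← Nat.cast_inj (R := ℚ)]
  simp only [Finset.sum_apply, Pi.smul_apply, smul_eq_mul] at hj
  simp only [Finsupp.add_apply, Finsupp.finsetSum_apply, Finsupp.smul_apply, smul_eq_mul,
    Nat.cast_add, Nat.cast_sum, Nat.cast_mul, hsplit, add_mul, Finset.sum_add_distrib, hD, ← hj,
    Finset.mul_sum, mul_assoc]
  rw [add_comm]

theorem isAlgebraic_of_mul_pow_eq {K R : Type*} [Field K] [CommRing R] [Algebra K R]
    (B : Subalgebra K R) {b c g : R} (hb : b ∈ B) (hc : c ∈ B) (hb0 : b ≠ 0) {N : ℕ} (hN : 0 < N)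
    (h : b * g ^ N = c) : IsAlgebraic B g := by
  refine ⟨Polynomial.C (⟨b, hb⟩ : B) * Polynomial.X ^ N - Polynomial.C (⟨c, hc⟩ : B),
    fun h0 => hb0 ?_, ?_⟩
  · have := congrArg (fun p : Polynomial B => p.coeff N) h0
    simp only [Polynomial.coeff_sub, Polynomial.coeff_C_mul_X_pow, if_pos, Polynomial.coeff_C,
      if_neg hN.ne', sub_zero, Polynomial.coeff_zero] at this
    exact congrArg Subtype.val this
  · rw [map_sub, map_mul, map_pow, Polynomial.aeval_X, Polynomial.aeval_C, Polynomial.aeval_C]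
    exact sub_eq_zero.2 h

/-- Independence of the exponents gives algebraic independence. Spanning gives for each generator
`g` an equation `b * g ^ N = c` with `b`, `c` monomials in the chosen ones. -/
theorem isTranscendenceBasis_monomialGenerator (v : Fin m → (Fin s →₀ ℕ)) {κ : Type*} [Finite κ]
    (a : κ → Fin m) (hli : LinearIndependent ℚ fun k j => (v (a k) j : ℚ))
    (hspan : ∀ i, (fun j => (v i j : ℚ)) ∈
      Submodule.span ℚ (Set.range fun k j => (v (a k) j : ℚ))) :
    IsTranscendenceBasis K fun k => monomialGenerator K v (a k) := by
  have := Fintype.ofFinite κ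
  rw [isTranscendenceBasis_iff_algebraicIndependent_isAlgebraic]
  constructor
  · exact AlgebraicIndependent.of_comp (monomialSubring K v).val
      (algebraicIndependent_monomial _ hli)
  · set B := Algebra.adjoin K (Set.range fun k => monomialGenerator K v (a k))
    have hgen : ∀ i, IsAlgebraic B (monomialGenerator K v i) := by
      intro i
      obtain ⟨N, b, c, hN, h⟩ := exists_nat_relation _ _ (hspan i)
      have hmem : ∀ d : κ → ℕ, ∏ k, monomialGenerator K v (a k) ^ d k ∈ B := fun d =>
        prod_mem fun k _ => pow_mem (Algebra.subset_adjoin (Set.mem_range_self k)) _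
      have hval : ∀ d : κ → ℕ, ((∏ k, monomialGenerator K v (a k) ^ d k : monomialSubring K v) :
          MvPolynomial (Fin s) K) = monomial (∑ k, d k • v (a k)) 1 := fun d => by
        rw [monomial_sum_one]
        push_cast
        refine Finset.prod_congr rfl fun k _ => ?_
        change monomial (v (a k)) (1 : K) ^ d k = _
        rw [monomial_pow, one_pow]
      let g := monomialGenerator K v
      have hrel : (∏ k, g (a k) ^ b k) * g i ^ N = ∏ k, g (a k) ^ c k := by
        refine Subtype.ext ?_
        have hN' : ((g i ^ N : monomialSubring K v) : MvPolynomial (Fin s) K) =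
            monomial (N • v i) 1 := by
          change monomial (v i) (1 : K) ^ N = _
          rw [monomial_pow, one_pow]
        rw [Subalgebra.coe_mul, hval, hval, hN', monomial_mul, mul_one, add_comm, h]
      have hne : (∏ k, g (a k) ^ b k) ≠ 0 := fun h0 => by
        have := congrArg (fun z : monomialSubring K v => (z : MvPolynomial (Fin s) K)) h0
        simp only [g, hval] at this
        exact one_ne_zero (monomial_eq_zero.1 this)
      exact isAlgebraic_of_mul_pow_eq B (hmem b) (hmem c) hne hN hrel
    have htop : (⊤ : Subalgebra K (monomialSubring K v)) ≤
        (Subalgebra.algebraicClosure B (monomialSubring K v)).restrictScalars K := by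
      rw [← adjoin_range_monomialGenerator, Algebra.adjoin_le_iff]
      rintro _ ⟨i, rfl⟩
      exact hgen i
    exact ⟨fun a => htop trivial⟩

/-- A maximal linearly independent set of columns yields a transcendence basis with as many elements
as the rank, and all transcendence bases of this domain are equinumerous. -/
theorem rank_exponentMatrix_eq {v : Fin m → (Fin s →₀ ℕ)} {k : ℕ}
    {x : Fin k → monomialSubring K v} (hx : IsTranscendenceBasis K x) :
    (exponentMatrix v).rank = k := by
  obtain ⟨κ, a, ha, hspan, hli⟩ := exists_linearIndependent' ℚ fun (i : Fin m) (j : Fin s) =>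
    (v i j : ℚ)
  have := Finite.of_injective a ha
  have := Fintype.ofFinite κ
  have hb := isTranscendenceBasis_monomialGenerator (K := K) v a hli fun i => by
    change _ ∈ Submodule.span ℚ (Set.range ((fun (i : Fin m) (j : Fin s) => (v i j : ℚ)) ∘ a))
    rw [hspan]
    exact Submodule.subset_span ⟨i, rfl⟩
  have hcard := hx.lift_cardinalMk_eq hb
  rw [Matrix.rank_eq_finrank_span_cols]
  change Module.finrank ℚ (Submodule.span ℚ (Set.range fun (i : Fin m) (j : Fin s) =>
    (v i j : ℚ))) = k
  rw [← hspan, finrank_span_eq_card hli]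
  simpa using hcard.symm

end MonomialSubring

theorem mainTheorem5 {K : Type*} [Field K] {s m : ℕ} (v : Fin m → (Fin s →₀ ℕ))
    (𝒜 : ℕ → Submodule K (monomialSubring K v)) [GradedAlgebra 𝒜]
    (hstd : IsStandardGraded 𝒜) (hCM : IsCohenMacaulay (monomialSubring K v)) :
    HasAInvariant 𝒜 (aInvariant 𝒜) ∧ HasRegularity 𝒜 (regularity 𝒜) ∧
      regularity 𝒜 = aInvariant 𝒜 + ((exponentMatrix v).rank : ℤ) := by
  classical
  have : Algebra.FiniteType K (monomialSubring K v) :=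
    ⟨⟨Finset.univ.image (monomialGenerator K v), by
      rw [Finset.coe_image, Finset.coe_univ, Set.image_univ, adjoin_range_monomialGenerator]⟩⟩
  obtain ⟨l, J, t, hl, hJ, ht, ha, hr⟩ := exists_isHomogeneousRegular_of_isCohenMacaulay hstd hCM
  obtain ⟨n, x, hx⟩ := exists_isLinearGenerators hstd
  have hrank := rank_exponentMatrix_eq
    (hl.isTranscendenceBasis (finiteDimensional_graded hx) hJ ht)
  have ha' : HasAInvariant 𝒜 (aInvariant 𝒜) := by
    have h : ∃ a, HasAInvariant 𝒜 a := ⟨_, ha⟩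
    rw [aInvariant, dif_pos h]
    exact h.choose_spec
  have hr' : HasRegularity 𝒜 (regularity 𝒜) := by
    have h : ∃ r, HasRegularity 𝒜 r := ⟨_, hr⟩
    rw [regularity, dif_pos h]
    exact h.choose_spec
  refine ⟨ha', hr', ?_⟩
  rw [hr'.unique hr, ha'.unique ha, hrank]
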